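/- For $n,z\in\mathbb C$ let ${\rm He}_n(z)$ denote the Hermite function $${\rm He}_n(z)=-\frac{\Gamma(n+1)}{2\pi {\rm i}}\int_C e^{-zt-\frac{t^2}{2}}(-t)^{-n-1}\,dt,\qquad |\arg(-t)|<\pi,$$ where $C$ comes in from $+\infty$ above the positive real axis, encircles the origin once in the positive direction and returns to $+\infty$ below the positive real axis; for $n=-1,-2,\dots$, where $\Gamma(n+1)$ has a pole, ${\rm He}_n(z)$ is defined by continuity in $n$ (removable singularity). Let $n,\epsilon\in\mathbb C$ be fixed with $\epsilon\neq0$, let $\sqrt\epsilon$ be either square root of $\epsilon$, put ${\rm i}^n=e^{\pi {\rm i} n/2}$, and define $$M(n;\lambda;\epsilon)={\rm i}^n\begin{pmatrix} {\rm He}_{n}\big(\frac{\lambda}{\sqrt{\epsilon}}\big){\rm He}_{-n}\big({\rm i}\frac{\lambda}{\sqrt{\epsilon}}\big)&-{\rm i}\sqrt\epsilon\, n\,{\rm He}_{n}\big(\frac{\lambda}{\sqrt{\epsilon}}\big){\rm He}_{-n-1}\big({\rm i}\frac{\lambda}{\sqrt{\epsilon}}\big)\\ \frac1{\sqrt\epsilon}{\rm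 He}_{n-1}\big(\frac{\lambda}{\sqrt{\epsilon}}\big){\rm He}_{-n}\big({\rm i}\frac{\lambda}{\sqrt{\epsilon}}\big)&-{\rm i}\,n\,{\rm He}_{n-1}\big(\frac{\lambda}{\sqrt{\epsilon}}\big){\rm He}_{-n-1}\big({\rm i}\frac{\lambda}{\sqrt{\epsilon}}\big) \end{pmatrix}.$$ Let $x=n\epsilon$ and let $R(x;\lambda;\epsilon)$ be the formal power series in $\lambda^{-1}$ (the formal GUE matrix resolvent) $$R(x;\lambda;\epsilon)=\begin{pmatrix}1&0\\0&0\end{pmatrix}+\sum_{k=0}^{\infty}\epsilon^k\frac{(2k-1)!!}{\lambda^{2k+2}}\begin{pmatrix} \epsilon n(2k+1)e_{n,2k+1}&-\epsilon n\lambda\, g_{n+1,2k}\\ \lambda\, g_{n,2k}&-\epsilon n(2k+1)e_{n,2k+1}\end{pmatrix},$$ where $(-1)!!=1$, $e_{n,2k+1}={}_2F_1(-k,1-n;2;2)$ and $g_{n,2k}={}_2F_1(-k,1-n;1;2)$ (terminating Gauss hypergeometric series). Then, as $\lambda\to\infty$ within the sector $-\frac{3\pi}{4}<\arg\big(\frac{\lambda}{\sqrt\epsilon}\big)<\frac{\pi}{4}$,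 the asymptotic expansion of $M(n;\lambda;\epsilon)$ to all orders coincides with $R(x;\lambda;\epsilon)$. That is, writing $R(x;\lambda;\epsilon)=\sum_{m\ge0}R_m\lambda^{-m}$, for every $\delta>0$ and every integer $N\ge 0$, $$M(n;\lambda;\epsilon)=\sum_{m=0}^{N}R_m\lambda^{-m}+O(\lambda^{-N-1})\qquad(\lambda\to\infty)$$ entrywise, uniformly in the closed subsector $-\frac{3\pi}{4}+\delta\le\arg\big(\frac{\lambda}{\sqrt\epsilon}\big)\le\frac{\pi}{4}-\delta$. -/

import Mathlib

open scoped Nat Topology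

noncomputable section

/-- Integral of `f` along the contour that comes in from `+∞ + i` along the line `Im t = 1` to
`-1 + i`, goes down to `-1 - i`, and returns to `+∞ - i` along the line `Im t = -1`, so that it
encircles the origin once in the positive direction without meeting the half-line `[0, ∞)`. -/
def loopIntegral (f : ℂ → ℂ) : ℂ :=
  -(∫ s in Set.Ioi (-1 : ℝ), f ((s : ℂ) + Complex.I))
    + (∫ y in (1 : ℝ)..(-1), f (-1 + (y : ℂ) * Complex.I) * Complex.I)
    + ∫ s in Set.Ioi (-1 : ℝ), f ((s : ℂ) - Complex.I)

/-- `-Γ(n+1)/(2πi) ∫_C exp(-zt - t²/2) (-t)^(-n-1) dt`, where the power is the principal one,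
`|arg (-t)| < π`. It is meaningful unless `n` is a negative integer, where `Γ(n+1)` has a pole. -/
def hermiteContour (n z : ℂ) : ℂ :=
  -(Complex.Gamma (n + 1) / (2 * (Real.pi : ℂ) * Complex.I)) *
    loopIntegral (fun t => Complex.exp (-z * t - t ^ 2 / 2) * (-t) ^ (-n - 1))

open scoped Classical in
/-- The Hermite function `He_n(z)`, `n, z ∈ ℂ`: the contour integral, and its continuous extension
in `n` when `n` is a negative integer (where the pole of `Γ(n+1)` cancels a zero of the integral,
so that the singularity in `n` is removable). -/
def hermiteHe (n z : ℂ) : ℂ :=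
  if ∃ k : ℕ, n = -((k : ℂ) + 1) then Filter.limUnder (𝓝[≠] n) (fun m => hermiteContour m z)
  else hermiteContour n z

/-- The matrix `M(n; λ; ε)`, with `s = √ε`. -/
def hermiteMatrix (n s lam : ℂ) : Matrix (Fin 2) (Fin 2) ℂ :=
  Complex.I ^ n •
    !![hermiteHe n (lam / s) * hermiteHe (-n) (Complex.I * (lam / s)),
        -Complex.I * s * n * hermiteHe n (lam / s) * hermiteHe (-n - 1) (Complex.I * (lam / s));
      s⁻¹ * hermiteHe (n - 1) (lam / s) * hermiteHe (-n) (Complex.I * (lam / s)),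
        -Complex.I * n * hermiteHe (n - 1) (lam / s) * hermiteHe (-n - 1) (Complex.I * (lam / s))]

/-- `e_{n,2k+1} = ₂F₁(-k, 1-n; 2; 2)` (a terminating series). -/
def eCoeff (n : ℂ) (k : ℕ) : ℂ := ordinaryHypergeometric (-(k : ℂ)) (1 - n) 2 (2 : ℂ)

/-- `g_{n,2k} = ₂F₁(-k, 1-n; 1; 2)` (a terminating series). -/
def gCoeff (n : ℂ) (k : ℕ) : ℂ := ordinaryHypergeometric (-(k : ℂ)) (1 - n) 1 (2 : ℂ)

/-- The coefficient of `λ^(-m)` in the formal matrix resolvent: `diag(1, 0)` for `m = 0`, an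
antidiagonal matrix for `m = 2k+1`, a diagonal one for `m = 2k+2`. Here `(2k-1)‼ = 1` for `k = 0`. -/
def resolventCoeff (n ε : ℂ) : ℕ → Matrix (Fin 2) (Fin 2) ℂ
  | 0 => !![1, 0; 0, 0]
  | j + 1 =>
    let k := j / 2
    if Even j then
      (ε ^ k * ((2 * k - 1)‼ : ℕ) : ℂ) • !![0, -(ε * n * gCoeff (n + 1) k); gCoeff n k, 0]
    else
      (ε * n * ε ^ k * ((2 * k - 1)‼ : ℕ) * (2 * k + 1) * eCoeff n k : ℂ) • !![1, 0; 0, -1]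

/-- The formal matrix resolvent `R(x; λ; ε)`, `x = nε`, of the GUE solution, as a formal power
series in `λ⁻¹` with matrix coefficients. -/
def formalResolvent (n ε : ℂ) : PowerSeries (Matrix (Fin 2) (Fin 2) ℂ) :=
  PowerSeries.mk (resolventCoeff n ε)

/-- Asymptotic expansion to all orders (in the sense of Poincaré) along the filter `l`: for every
`N`, entrywise, `F(λ) = ∑_{m ≤ N} R_m λ^(-m) + O(λ^(-N-1))`. -/
def HasAsymptoticExpansion (F : ℂ → Matrix (Fin 2) (Fin 2) ℂ)
    (R : PowerSeries (Matrix (Fin 2) (Fin 2) ℂ)) (l : Filter ℂ) : Prop :=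
  ∀ (N : ℕ) (a b : Fin 2),
    (fun lam : ℂ => F lam a b -
        ∑ m ∈ Finset.range (N + 1), PowerSeries.coeff m R a b * (lam⁻¹) ^ m)
      =O[l] fun lam : ℂ => (lam⁻¹) ^ (N + 1)

/-- `λ → ∞` within the closed subsector `-3π/4 + δ ≤ arg (λ/s) ≤ π/4 - δ`. -/
def atInftySector (s : ℂ) (δ : ℝ) : Filter ℂ :=
  Bornology.cobounded ℂ ⊓ Filter.principal
    {lam : ℂ | -(3 * Real.pi / 4) + δ ≤ Complex.arg (lam / s) ∧
      Complex.arg (lam / s) ≤ Real.pi / 4 - δ}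

end

noncomputable section

open Complex MeasureTheory Filter Set Asymptotics

/-! With z = λ/√ε, every entry of M is an elementary factor times a product He_m(z) He_{-n'}(iz).
The theorem therefore splits into an analytic statement about one Hermite function and an algebraic
one about products of formal series.

Analytic half (`hasAsympSeries_hermiteHe`): z^(-n) He_n(z) has the expansion `hermiteSeries n` in
z⁻² throughout |arg z| < 3π/4. For Re n < -1 the loop collapses onto the positive half-line. The
Gaussian allows that ray to be turned by any angle below π/4 (`hermiteMellin_eq_rotated`), and
Watson's lemma (`norm_integral_sub_sum_le`) gives the expansion. The recurrence `hermiteHe_add_one`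
carries it to all n. The sector of the theorem is exactly where z and iz both have |arg| < 3π/4.

Formal half: let S_n be `hermiteSeries n` and D_n be `dualHermiteSeries n`, the expansion of (iz)^n
He_{-n}(iz). The recurrences of S and D yield a Wronskian identity (formally, tr M = 1) and two
relations linking the products S_n D_n and S_{n-1} D_n. The numbers `eCoeff` and `gCoeff` satisfy
the same relations (`gCoeff_succ`, `eCoeff_difference`). Since all coefficients are polynomials in
n, these relations determine them (`coeff_hermiteSeries_products`). -/

/-! ### The loop integral: bounds, continuity in the exponent, recurrence. -/

/-- The integrand `exp(-zt - t²/2) (-t)^a` of the Hankel-type contour integral. -/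
def hankelIntegrand (z a t : ℂ) : ℂ := exp (-z * t - t ^ 2 / 2) * (-t) ^ a

lemma norm_cpow_le_exp {w a : ℂ} {A : ℝ} (ha : ‖a‖ ≤ A) (h : 1 ≤ ‖w‖ ∨ 0 ≤ a.re) :
    ‖w ^ a‖ ≤ Real.exp (A * ‖w‖ + Real.pi * A) := by
  have hA : 0 ≤ A := (norm_nonneg a).trans ha
  have h1 : ‖w‖ ^ a.re ≤ Real.exp (A * ‖w‖) := by
    by_cases hw : 1 ≤ ‖w‖
    · calc ‖w‖ ^ a.re ≤ ‖w‖ ^ A :=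
            Real.rpow_le_rpow_of_exponent_le hw ((re_le_norm a).trans ha)
        _ ≤ (Real.exp ‖w‖) ^ A := by
            refine Real.rpow_le_rpow (norm_nonneg _) ?_ hA
            linarith [Real.add_one_le_exp ‖w‖]
        _ = Real.exp (A * ‖w‖) := by rw [← Real.exp_mul, mul_comm]
    · calc ‖w‖ ^ a.re ≤ 1 := Real.rpow_le_one (norm_nonneg _) (le_of_not_ge hw) (h.resolve_left hw)
        _ ≤ _ := Real.one_le_exp (by positivity)
  have h2 : Real.exp (-(arg w * a.im)) ≤ Real.exp (Real.pi * A) := by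
    apply Real.exp_le_exp.2
    calc -(arg w * a.im) ≤ |arg w * a.im| := neg_le_abs _
      _ = |arg w| * |a.im| := abs_mul _ _
      _ ≤ Real.pi * A := mul_le_mul (abs_arg_le_pi w) ((abs_im_le_norm a).trans ha)
          (abs_nonneg _) Real.pi_pos.le
  calc ‖w ^ a‖ ≤ ‖w‖ ^ a.re / Real.exp (arg w * a.im) := norm_cpow_le _ _
    _ = ‖w‖ ^ a.re * Real.exp (-(arg w * a.im)) := by rw [Real.exp_neg, div_eq_mul_inv]
    _ ≤ Real.exp (A * ‖w‖) * Real.exp (Real.pi * A) :=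
        mul_le_mul h1 h2 (Real.exp_pos _).le (Real.exp_pos _).le
    _ = _ := by rw [Real.exp_add]

lemma norm_exp_quadratic_le (z : ℂ) {t : ℂ} (ht : |t.im| ≤ 1) :
    ‖exp (-z * t - t ^ 2 / 2)‖ ≤ Real.exp (‖z‖ * (|t.re| + 1) - t.re ^ 2 / 2 + 1 / 2) := by
  rw [norm_exp]
  apply Real.exp_le_exp.2
  have h1 : (-z * t).re ≤ ‖z‖ * (|t.re| + 1) := by
    calc (-z * t).re ≤ ‖-z * t‖ := re_le_norm _
      _ = ‖z‖ * ‖t‖ := by rw [norm_mul, norm_neg]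
      _ ≤ _ := by
        gcongr
        linarith [norm_le_abs_re_add_abs_im t]
  have h2 : (t ^ 2 / 2).re = (t.re ^ 2 - t.im ^ 2) / 2 := by
    rw [show (2 : ℂ) = ((2 : ℝ) : ℂ) by norm_num, div_ofReal_re, pow_two, mul_re]; ring
  have h3 : t.im ^ 2 ≤ 1 := (sq_le_one_iff_abs_le_one _).2 ht
  rw [sub_re, h2]
  linarith

/-- The Gaussian absorbs the linear exponent and the power. Uniformity in the exponent `a` makes
this a dominating function for continuity in the order, and `w` stays separate from `t` so that the
bound serves `-t`, `±i t` and `t` alike. -/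
lemma exists_bound_exp_mul_cpow (z : ℂ) (A : ℝ) : ∃ C : ℝ, 0 ≤ C ∧ ∀ t w a : ℂ, |t.im| ≤ 1 →
    ‖w‖ = ‖t‖ → ‖a‖ ≤ A → (1 ≤ ‖t‖ ∨ 0 ≤ a.re) →
    ‖exp (-z * t - t ^ 2 / 2) * w ^ a‖ ≤ C * Real.exp (-t.re) := by
  -- The last term is the maximum over x of (‖z‖ + A + 1) x - x²/2; the extra 1 in the slope pays
  -- for the factor `exp (-t.re)`.
  refine ⟨Real.exp (‖z‖ + 1 / 2 + A + Real.pi * A + (‖z‖ + A + 1) ^ 2 / 2), (Real.exp_pos _).le, ?_⟩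
  intro t w a ht hw ha h
  have hA : 0 ≤ A := (norm_nonneg a).trans ha
  rw [norm_mul, ← Real.exp_add]
  refine (mul_le_mul (norm_exp_quadratic_le z ht) (norm_cpow_le_exp ha (hw ▸ h)) (norm_nonneg _)
    (Real.exp_pos _).le).trans ?_
  rw [← Real.exp_add]
  apply Real.exp_le_exp.2
  have h1 : A * ‖w‖ ≤ A * (|t.re| + 1) := by
    gcongr
    rw [hw]
    linarith [norm_le_abs_re_add_abs_im t]
  have h2 := sq_nonneg (|t.re| - (‖z‖ + A + 1))
  have h3 : |t.re| ^ 2 = t.re ^ 2 := sq_abs _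
  have h4 : t.re ≤ |t.re| := le_abs_self _
  nlinarith

lemma neg_mem_slitPlane_of_im_ne_zero {t : ℂ} (h : t.im ≠ 0) : -t ∈ slitPlane :=
  Or.inr (by simpa using h)

lemma neg_mem_slitPlane_of_re_neg {t : ℂ} (h : t.re < 0) : -t ∈ slitPlane :=
  Or.inl (by simpa using h)

lemma continuousAt_hankelIntegrand {z a t : ℂ} (h : -t ∈ slitPlane) :
    ContinuousAt (fun t => hankelIntegrand z a t) t := by
  unfold hankelIntegrand
  refine ContinuousAt.mul (by fun_prop) (ContinuousAt.cpow (by fun_prop) continuousAt_const h)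

lemma continuousAt_hankelIntegrand_exponent {z a t : ℂ} (h : -t ∈ slitPlane) :
    ContinuousAt (fun p : ℂ × ℂ => hankelIntegrand z p.1 p.2) (a, t) := by
  unfold hankelIntegrand
  refine ContinuousAt.mul (by fun_prop) (ContinuousAt.cpow (by fun_prop) (by fun_prop) h)

/-- The derivative stays within the same family, with exponents a + 1, a and a - 1; integrating it
along the loop produces the three-term recurrence. -/
lemma hasDerivAt_hankelIntegrand {z a t : ℂ} (h : -t ∈ slitPlane) :
    HasDerivAt (fun t => hankelIntegrand z a t)
      (hankelIntegrand z (a + 1) t - z * hankelIntegrand z a t - a * hankelIntegrand z (a - 1) t)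
      t := by
  have h0 : -t ≠ 0 := slitPlane_ne_zero h
  have h1 : HasDerivAt (fun t : ℂ => exp (-z * t - t ^ 2 / 2))
      (exp (-z * t - t ^ 2 / 2) * (-z - t)) t := by
    have : HasDerivAt (fun t : ℂ => -z * t - t ^ 2 / 2) (-z - t) t := by
      refine (((hasDerivAt_id' t).const_mul (-z)).sub
        ((hasDerivAt_pow 2 t).div_const 2)).congr_deriv ?_
      push_cast
      ring
    exact this.cexp
  have h2 : HasDerivAt (fun t : ℂ => (-t) ^ a) (a * (-t) ^ (a - 1) * (-1)) t :=
    (hasDerivAt_id t).neg.cpow_const h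
  refine (h1.mul h2).congr_deriv ?_
  unfold hankelIntegrand
  rw [cpow_add _ _ h0, cpow_one]
  ring

lemma integrableOn_hankelIntegrand_line (z a : ℂ) {c : ℂ} (hre : c.re = 0) (him : |c.im| = 1) :
    IntegrableOn (fun s : ℝ => hankelIntegrand z a (s + c)) (Ioi (-1)) := by
  obtain ⟨C, -, hC⟩ := exists_bound_exp_mul_cpow z ‖a‖
  have hc : Continuous (fun s : ℝ => hankelIntegrand z a (s + c)) := by
    refine continuous_iff_continuousAt.2 fun s => ?_
    have hs : -((s : ℂ) + c) ∈ slitPlane :=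
      neg_mem_slitPlane_of_im_ne_zero (by
        intro h
        simp only [add_im, ofReal_im, zero_add] at h
        simp [h] at him)
    exact ContinuousAt.comp (f := fun s : ℝ => (s : ℂ) + c)
      (continuousAt_hankelIntegrand hs) (by fun_prop)
  have hexp := (integrableOn_exp_neg_Ioi (-1)).const_mul C
  refine Integrable.mono' hexp hc.aestronglyMeasurable (ae_of_all _ fun s => ?_)
  have := hC (s + c) (-(s + c)) a (by simp [him]) (norm_neg _) le_rfl (Or.inl ?_)
  · simpa [hankelIntegrand, hre] using this
  · calc (1 : ℝ) = |((s : ℂ) + c).im| := by simp [him]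
      _ ≤ _ := abs_im_le_norm _

lemma continuous_integral_hankelIntegrand_line (z : ℂ) {c : ℂ} (hre : c.re = 0) (him : |c.im| = 1) :
    Continuous (fun a : ℂ => ∫ s in Ioi (-1 : ℝ), hankelIntegrand z a (s + c)) := by
  refine continuous_iff_continuousAt.2 fun a₀ => ?_
  obtain ⟨C, -, hC⟩ := exists_bound_exp_mul_cpow z (‖a₀‖ + 1)
  refine continuousAt_of_dominated (bound := fun s => C * Real.exp (-s))
    (Eventually.of_forall fun a => (integrableOn_hankelIntegrand_line z a hre him).1) ?_
    ((integrableOn_exp_neg_Ioi (-1)).const_mul C) (ae_of_all _ fun s => ?_)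
  · filter_upwards [Metric.ball_mem_nhds a₀ one_pos] with a ha
    have ha' : ‖a‖ ≤ ‖a₀‖ + 1 := by
      have := norm_le_norm_add_norm_sub' a a₀
      rw [Metric.mem_ball, dist_eq_norm] at ha
      linarith
    refine ae_of_all _ fun s => ?_
    have := hC (s + c) (-(s + c)) a (by simp [him]) (norm_neg _) ha' (Or.inl ?_)
    · simpa [hankelIntegrand, hre] using this
    · calc (1 : ℝ) = |((s : ℂ) + c).im| := by simp [him]
        _ ≤ _ := abs_im_le_norm _
  · have hs : -((s : ℂ) + c) ∈ slitPlane :=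
      neg_mem_slitPlane_of_im_ne_zero (by
        intro h
        simp only [add_im, ofReal_im, zero_add] at h
        simp [h] at him)
    exact ContinuousAt.comp (f := fun a : ℂ => (a, (s : ℂ) + c))
      (continuousAt_hankelIntegrand_exponent hs) (by fun_prop)

lemma re_neg_one_add_mul_I (y : ℝ) : (-1 + (y : ℂ) * I).re < 0 := by simp

lemma continuous_hankelIntegrand_vertical (z : ℂ) :
    Continuous (fun p : ℂ × ℝ => hankelIntegrand z p.1 (-1 + (p.2 : ℂ) * I)) := by
  refine continuous_iff_continuousAt.2 fun p => ?_
  exact ContinuousAt.comp (f := fun p : ℂ × ℝ => (p.1, -1 + (p.2 : ℂ) * I))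
    (continuousAt_hankelIntegrand_exponent
      (neg_mem_slitPlane_of_re_neg (re_neg_one_add_mul_I p.2))) (by fun_prop)

lemma continuous_hankelIntegrand_vertical' (z a : ℂ) :
    Continuous (fun y : ℝ => hankelIntegrand z a (-1 + (y : ℂ) * I)) :=
  (continuous_hankelIntegrand_vertical z).comp (f := fun y : ℝ => (a, y)) (by fun_prop)

lemma loopIntegral_hankelIntegrand (z a : ℂ) : loopIntegral (hankelIntegrand z a) =
    -(∫ s in Ioi (-1 : ℝ), hankelIntegrand z a (s + I))
    + (∫ y in (1 : ℝ)..(-1), hankelIntegrand z a (-1 + (y : ℂ) * I)) * I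
    + ∫ s in Ioi (-1 : ℝ), hankelIntegrand z a (s + -I) := by
  simp only [loopIntegral, sub_eq_add_neg, intervalIntegral.integral_mul_const]

lemma continuous_loopIntegral_hankelIntegrand (z : ℂ) :
    Continuous (fun a => loopIntegral (hankelIntegrand z a)) := by
  simp_rw [loopIntegral_hankelIntegrand]
  refine ((continuous_integral_hankelIntegrand_line z (c := I) (by simp) (by simp)).neg.add
    (Continuous.mul ?_ continuous_const)).add
    (continuous_integral_hankelIntegrand_line z (c := -I) (by simp) (by simp))
  exact intervalIntegral.continuous_parametric_intervalIntegral_of_continuous'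
    (f := fun a y => hankelIntegrand z a (-1 + (y : ℂ) * I))
    (continuous_hankelIntegrand_vertical z) _ _

lemma tendsto_hankelIntegrand_line (z a : ℂ) {c : ℂ} (hre : c.re = 0) (him : |c.im| = 1) :
    Tendsto (fun s : ℝ => hankelIntegrand z a (s + c)) atTop (𝓝 0) := by
  obtain ⟨C, -, hC⟩ := exists_bound_exp_mul_cpow z ‖a‖
  refine squeeze_zero_norm (a := fun s : ℝ => C * Real.exp (-s)) (fun s => ?_) ?_
  · have := hC (s + c) (-(s + c)) a (by simp [him]) (norm_neg _) le_rfl (Or.inl ?_)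
    · simpa [hankelIntegrand, hre] using this
    · calc (1 : ℝ) = |((s : ℂ) + c).im| := by simp [him]
        _ ≤ _ := abs_im_le_norm _
  · simpa using (Real.tendsto_exp_neg_atTop_nhds_zero).const_mul C

lemma integral_deriv_hankelIntegrand_line (z a : ℂ) {c : ℂ} (hre : c.re = 0) (him : |c.im| = 1) :
    (∫ s in Ioi (-1 : ℝ), hankelIntegrand z (a + 1) (s + c))
      - z * (∫ s in Ioi (-1 : ℝ), hankelIntegrand z a (s + c))
      - a * (∫ s in Ioi (-1 : ℝ), hankelIntegrand z (a - 1) (s + c))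
      = -hankelIntegrand z a (-1 + c) := by
  have hi := fun b => integrableOn_hankelIntegrand_line z b hre him
  rw [← integral_const_mul, ← integral_const_mul, ← integral_sub (hi _) ((hi _).const_mul _),
    ← integral_sub (f := fun s : ℝ => hankelIntegrand z (a + 1) (s + c) -
      z * hankelIntegrand z a (s + c)) ((hi _).sub ((hi _).const_mul _)) ((hi _).const_mul _)]
  have key := integral_Ioi_of_hasDerivAt_of_tendsto' (a := -1)
    (f := fun s : ℝ => hankelIntegrand z a (s + c)) (m := 0)
    (f' := fun s : ℝ => hankelIntegrand z (a + 1) (s + c) - z * hankelIntegrand z a (s + c)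
      - a * hankelIntegrand z (a - 1) (s + c)) (fun s _ => ?_)
    (((hi _).sub ((hi _).const_mul _)).sub ((hi _).const_mul _))
    (tendsto_hankelIntegrand_line z a hre him)
  · simpa using key
  · have hs : -((s : ℂ) + c) ∈ slitPlane :=
      neg_mem_slitPlane_of_im_ne_zero (by
        intro h
        simp only [add_im, ofReal_im, zero_add] at h
        simp [h] at him)
    exact (HasDerivAt.comp_add_const (s : ℂ) c (hasDerivAt_hankelIntegrand hs)).comp_ofReal

lemma integral_deriv_hankelIntegrand_vertical (z a : ℂ) :
    ((∫ y in (1 : ℝ)..(-1), hankelIntegrand z (a + 1) (-1 + (y : ℂ) * I))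
      - z * (∫ y in (1 : ℝ)..(-1), hankelIntegrand z a (-1 + (y : ℂ) * I))
      - a * (∫ y in (1 : ℝ)..(-1), hankelIntegrand z (a - 1) (-1 + (y : ℂ) * I))) * I
      = hankelIntegrand z a (-1 - I) - hankelIntegrand z a (-1 + I) := by
  have hi := fun b => (continuous_hankelIntegrand_vertical' z b).intervalIntegrable
    (μ := volume) 1 (-1)
  rw [← intervalIntegral.integral_const_mul, ← intervalIntegral.integral_const_mul,
    ← intervalIntegral.integral_sub (hi _) ((hi _).const_mul _),
    ← intervalIntegral.integral_sub ((hi _).sub ((hi _).const_mul _)) ((hi _).const_mul _),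
    ← intervalIntegral.integral_mul_const]
  rw [intervalIntegral.integral_eq_sub_of_hasDerivAt
    (f := fun y : ℝ => hankelIntegrand z a (-1 + (y : ℂ) * I)) (fun y _ => ?_)
    ((((hi _).sub ((hi _).const_mul _)).sub ((hi _).const_mul _)).mul_const _)]
  · simp [sub_eq_add_neg]
  · have h1 : HasDerivAt (fun y : ℂ => -1 + y * I) I (y : ℂ) := by
      simpa using ((hasDerivAt_id (y : ℂ)).mul_const I).const_add (-1)
    exact (HasDerivAt.comp (y : ℂ) (hasDerivAt_hankelIntegrand
      (neg_mem_slitPlane_of_re_neg (re_neg_one_add_mul_I y))) h1).comp_ofReal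

/-- A derivative is integrated along the loop: the values at the corners -1 ± i cancel between
adjacent pieces, and the ends at +∞ contribute nothing. -/
lemma loopIntegral_hankelIntegrand_recurrence (z a : ℂ) :
    loopIntegral (hankelIntegrand z (a + 1)) - z * loopIntegral (hankelIntegrand z a)
      - a * loopIntegral (hankelIntegrand z (a - 1)) = 0 := by
  simp only [loopIntegral_hankelIntegrand]
  have h1 := integral_deriv_hankelIntegrand_line z a (c := I) (by simp) (by simp)
  have h2 := integral_deriv_hankelIntegrand_line z a (c := -I) (by simp) (by simp)
  have h3 := integral_deriv_hankelIntegrand_vertical z a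
  rw [sub_eq_add_neg (-1) I] at h3
  linear_combination h2 - h1 + h3

lemma hermiteContour_eq (n z : ℂ) : hermiteContour n z =
    -(Gamma (n + 1) / (2 * (Real.pi : ℂ) * I)) * loopIntegral (hankelIntegrand z (-n - 1)) := rfl

lemma hermiteContour_recurrence {n : ℂ} (z : ℂ) (hn : ∀ k : ℕ, n ≠ -k) :
    hermiteContour (n + 1) z = z * hermiteContour n z - n * hermiteContour (n - 1) z := by
  have h := loopIntegral_hankelIntegrand_recurrence z (-n - 1)
  have h0 : n ≠ 0 := by simpa using hn 0
  have h1 : n + 1 ≠ 0 := fun h => hn 1 (by push_cast; linear_combination h)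
  rw [hermiteContour_eq, hermiteContour_eq, hermiteContour_eq, Gamma_add_one _ h1, sub_add_cancel,
    Gamma_add_one _ h0]
  rw [show -(n + 1) - 1 = -n - 1 - 1 by ring, show -(n - 1) - 1 = -n - 1 + 1 by ring]
  linear_combination (-n * Gamma n / (2 * (Real.pi : ℂ) * I)) * h

lemma continuousAt_hermiteContour {n : ℂ} (z : ℂ) (hn : ∀ k : ℕ, n ≠ -((k : ℂ) + 1)) :
    ContinuousAt (fun m => hermiteContour m z) n := by
  have hG : ContinuousAt (fun m : ℂ => Gamma (m + 1)) n := by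
    refine ContinuousAt.comp (f := fun m : ℂ => m + 1) (differentiableAt_Gamma _ fun k h => ?_).continuousAt
      (by fun_prop)
    exact hn k (by linear_combination h)
  exact ((hG.div_const _).neg).mul ((continuous_loopIntegral_hankelIntegrand z).comp
    (f := fun m => -m - 1) (by fun_prop)).continuousAt

/-! ### Collapsing the loop onto the half-line. -/

lemma mul_cpow_of_arg_add_arg_mem {x y : ℂ} (hx : x ≠ 0) (hy : y ≠ 0)
    (h : arg x + arg y ∈ Ioc (-Real.pi) Real.pi) (a : ℂ) : (x * y) ^ a = x ^ a * y ^ a := by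
  rw [cpow_def_of_ne_zero (mul_ne_zero hx hy), cpow_def_of_ne_zero hx, cpow_def_of_ne_zero hy,
    log_mul hx hy h, add_mul, exp_add]

/-- **Cauchy's theorem** on a half-strip for functions with exponential decay. -/
lemma integral_boundary_halfStrip {F : ℂ → ℂ} {y₁ y₂ C : ℝ} (hy : y₁ ≤ y₂)
    (hc : ContinuousOn F (Ici (-1) ×ℂ Icc y₁ y₂))
    (hd : DifferentiableOn ℂ F (Ioi (-1) ×ℂ Ioo y₁ y₂))
    (hF : ∀ t : ℂ, t.im ∈ Icc y₁ y₂ → ‖F t‖ ≤ C * Real.exp (-t.re)) :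
    (∫ x in Ioi (-1 : ℝ), F (x + y₁ * I)) - (∫ x in Ioi (-1 : ℝ), F (x + y₂ * I)) =
      I * ∫ y in y₁..y₂, F (-1 + y * I) := by
  have hint : ∀ y ∈ Icc y₁ y₂, IntegrableOn (fun x : ℝ => F (x + y * I)) (Ioi (-1)) := by
    intro y hyy
    refine Integrable.mono' ((integrableOn_exp_neg_Ioi (-1)).const_mul C) ?_ (ae_of_all _ fun x => ?_)
    · refine ContinuousOn.aestronglyMeasurable ?_ measurableSet_Ioi
      refine hc.comp (f := fun x : ℝ => (x : ℂ) + y * I) (by fun_prop) fun x hx => ?_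
      rw [mem_reProdIm]
      simpa using ⟨(mem_Ioi.1 hx).le, hyy⟩
    · simpa using hF (x + y * I) (by simpa using hyy)
  have hrect : ∀ R : ℝ, -1 ≤ R → (∫ x in (-1 : ℝ)..R, F (x + y₁ * I))
      - (∫ x in (-1 : ℝ)..R, F (x + y₂ * I)) + I * (∫ y in y₁..y₂, F (R + y * I))
      - I * (∫ y in y₁..y₂, F (-1 + y * I)) = 0 := by
    intro R hR
    have := integral_boundary_rect_eq_zero_of_continuousOn_of_differentiableOn F
      (-1 + y₁ * I) (R + y₂ * I) (hc.mono ?_) (hd.mono ?_)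
    · simpa using this
    · intro t ht
      rw [mem_reProdIm] at ht ⊢
      simp only [add_re, neg_re, one_re, mul_re, ofReal_re, I_re, mul_zero, ofReal_im, I_im,
        mul_one, sub_self, add_zero, add_im, neg_im, one_im, neg_zero, mul_im, zero_add,
        uIcc_of_le hR, uIcc_of_le hy] at ht
      exact ⟨ht.1.1, ht.2⟩
    · intro t ht
      rw [mem_reProdIm] at ht ⊢
      simp only [add_re, neg_re, one_re, mul_re, ofReal_re, I_re, mul_zero, ofReal_im, I_im,
        mul_one, sub_self, add_zero, add_im, neg_im, one_im, neg_zero, mul_im, zero_add,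
        min_eq_left hR, min_eq_left hy, max_eq_right hy] at ht
      exact ⟨ht.1.1, ht.2⟩
  -- The right side of the rectangle disappears as R → ∞, by the assumed decay.
  have hright : Tendsto (fun R : ℝ => ∫ y in y₁..y₂, F (R + y * I)) atTop (𝓝 0) := by
    refine squeeze_zero_norm (a := fun R : ℝ => C * Real.exp (-R) * |y₂ - y₁|) (fun R => ?_) ?_
    · refine intervalIntegral.norm_integral_le_of_norm_le_const fun y hy' => ?_
      rw [uIoc_of_le hy] at hy'
      simpa using hF (R + y * I) (by simpa using ⟨hy'.1.le, hy'.2⟩)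
    · simpa using (Real.tendsto_exp_neg_atTop_nhds_zero.const_mul C).mul_const |y₂ - y₁|
  have hlim := (((intervalIntegral_tendsto_integral_Ioi (-1) (hint y₁ ⟨le_rfl, hy⟩)
    tendsto_id).sub (intervalIntegral_tendsto_integral_Ioi (-1) (hint y₂ ⟨hy, le_rfl⟩)
    tendsto_id)).add (hright.const_mul I)).sub_const (I * ∫ y in y₁..y₂, F (-1 + y * I))
  have h0 := tendsto_nhds_unique hlim ((tendsto_const_nhds (x := (0 : ℂ))).congr' (by
    filter_upwards [eventually_ge_atTop (-1 : ℝ)] with R hR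
    exact (hrect R hR).symm))
  linear_combination h0

/-- The branch of `exp(-zt - t²/2) (-t)^a` that is continuous on the half-plane `0 ≤ Re (u t)`,
where `u = ±i`. -/
def hankelBranch (u z a t : ℂ) : ℂ := exp (-z * t - t ^ 2 / 2) * (u ^ a * (u * t) ^ a)

lemma differentiableAt_hankelBranch {u z a t : ℂ} (h : 0 < (u * t).re) :
    DifferentiableAt ℂ (hankelBranch u z a) t := by
  unfold hankelBranch
  refine DifferentiableAt.mul (by fun_prop) (DifferentiableAt.const_mul ?_ _)
  exact DifferentiableAt.cpow (by fun_prop) (by fun_prop) (Or.inl h)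

lemma continuousAt_hankelBranch {u z a t : ℂ} (ha : 0 < a.re) (h : 0 ≤ (u * t).re) :
    ContinuousAt (hankelBranch u z a) t := by
  unfold hankelBranch
  refine ContinuousAt.mul (by fun_prop) (ContinuousAt.mul continuousAt_const ?_)
  exact ContinuousAt.comp (f := fun t : ℂ => u * t) (g := fun w : ℂ => w ^ a)
    (continuousAt_cpow_const_of_re_pos (Or.inl h) ha) (by fun_prop)

lemma exists_bound_hankelBranch {u : ℂ} (hu : ‖u‖ = 1) (z : ℂ) {a : ℂ} (ha : 0 < a.re) :
    ∃ C : ℝ, ∀ t : ℂ, |t.im| ≤ 1 → ‖hankelBranch u z a t‖ ≤ C * Real.exp (-t.re) := by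
  obtain ⟨C, -, hC⟩ := exists_bound_exp_mul_cpow z ‖a‖
  refine ⟨‖u ^ a‖ * C, fun t ht => ?_⟩
  have := hC t (u * t) a ht (by rw [norm_mul, hu, one_mul]) le_rfl (Or.inr ha.le)
  calc ‖hankelBranch u z a t‖ = ‖u ^ a‖ * ‖exp (-z * t - t ^ 2 / 2) * (u * t) ^ a‖ := by
        rw [hankelBranch, norm_mul, norm_mul, norm_mul]; ring
    _ ≤ ‖u ^ a‖ * (C * Real.exp (-t.re)) := by gcongr
    _ = _ := by ring

/-- Here -t = i·(it), and π/2 + arg(it) lies in [0, π], inside the principal range even on the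
positive axis. For u = -i the sum of arguments would be the excluded -π there, whence the asymmetric
hypotheses of the two lemmas. -/
lemma hankelBranch_I_eq {z a t : ℂ} (ht : t ≠ 0) (him : t.im ≤ 0) :
    hankelBranch I z a t = hankelIntegrand z a t := by
  have hw : 0 ≤ (I * t).re := by simpa using him
  have h1 := abs_le.1 (abs_arg_le_pi_div_two_iff.2 hw)
  rw [hankelBranch, hankelIntegrand, ← mul_cpow_of_arg_add_arg_mem I_ne_zero
    (mul_ne_zero I_ne_zero ht), ← mul_assoc, I_mul_I, neg_one_mul]
  rw [arg_I]
  constructor <;> linarith [Real.pi_pos, h1.1, h1.2]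

lemma hankelBranch_neg_I_eq {z a t : ℂ} (ht : 0 < t.im ∨ 0 ≤ t.im ∧ t.re < 0) :
    hankelBranch (-I) z a t = hankelIntegrand z a t := by
  have ht0 : t ≠ 0 := by
    rintro rfl
    simp at ht
  have hw : 0 ≤ (-I * t).re := by
    rcases ht with h | h
    · simpa using h.le
    · simpa using h.1
  have h1 := abs_le.1 (abs_arg_le_pi_div_two_iff.2 hw)
  have h2 : -(Real.pi / 2) < arg (-I * t) := by
    rw [neg_pi_div_two_lt_arg_iff]
    rcases ht with h | h
    · left; simpa using h
    · right; simpa using h.2.le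
  rw [hankelBranch, hankelIntegrand, ← mul_cpow_of_arg_add_arg_mem (neg_ne_zero.2 I_ne_zero)
    (mul_ne_zero (neg_ne_zero.2 I_ne_zero) ht0), ← mul_assoc, neg_mul_neg, I_mul_I, neg_one_mul]
  rw [arg_neg_I]
  constructor <;> linarith [Real.pi_pos, h1.2]

lemma hankelBranch_ofReal {z a : ℂ} {u : ℂ} (hu : u ≠ 0) {x : ℝ} (hx : 0 < x) :
    hankelBranch u z a x = exp (2 * a * log u) * (exp (-z * x - (x : ℂ) ^ 2 / 2) * (x : ℂ) ^ a) := by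
  rw [hankelBranch, mul_cpow_of_arg_add_arg_mem hu (ofReal_ne_zero.2 hx.ne') (by
    rw [arg_ofReal_of_nonneg hx.le, add_zero]; exact arg_mem_Ioc u), cpow_def_of_ne_zero hu,
    show 2 * a * log u = log u * a + log u * a by ring, exp_add]
  ring

/-- Collapsing the Hankel loop onto the positive half-line. -/
lemma loopIntegral_hankelIntegrand_eq (z : ℂ) {a : ℂ} (ha : 0 < a.re) :
    loopIntegral (hankelIntegrand z a) = 2 * I * sin (Real.pi * a) *
      ∫ x in Ioi (0 : ℝ), exp (-z * x - (x : ℂ) ^ 2 / 2) * (x : ℂ) ^ a := by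
  obtain ⟨C₁, hC₁⟩ := exists_bound_hankelBranch (u := -I) (by simp) z ha
  obtain ⟨C₂, hC₂⟩ := exists_bound_hankelBranch (u := I) (by simp) z ha
  -- The cut `[0, ∞)` lies on the edge of both half-strips, so each half uses the branch continuous
  -- up to its edge; `0 < a.re` gives continuity at the branch point 0.
  have up := integral_boundary_halfStrip (F := hankelBranch (-I) z a) (y₁ := 0) (y₂ := 1)
    (C := C₁) zero_le_one
    (fun t ht => (continuousAt_hankelBranch ha (by simpa using ht.2.1)).continuousWithinAt)
    (fun t ht => (differentiableAt_hankelBranch (by simpa using ht.2.1)).differentiableWithinAt)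
    (fun t ht => hC₁ t (abs_le.2 ⟨by linarith [ht.1], ht.2⟩))
  have down := integral_boundary_halfStrip (F := hankelBranch I z a) (y₁ := -1) (y₂ := 0)
    (C := C₂) (by norm_num)
    (fun t ht => (continuousAt_hankelBranch ha (by simpa using ht.2.2)).continuousWithinAt)
    (fun t ht => (differentiableAt_hankelBranch (by simpa using ht.2.2)).differentiableWithinAt)
    (fun t ht => hC₂ t (abs_le.2 ⟨ht.1, by linarith [ht.2]⟩))
  have e1 : ∫ x in Ioi (-1 : ℝ), hankelBranch (-I) z a (x + (1 : ℝ) * I)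
      = ∫ x in Ioi (-1 : ℝ), hankelIntegrand z a (x + I) := by
    congr 1
    ext x
    rw [hankelBranch_neg_I_eq (by simp), ofReal_one, one_mul]
  have e2 : ∫ x in Ioi (-1 : ℝ), hankelBranch I z a (x + (-1 : ℝ) * I)
      = ∫ x in Ioi (-1 : ℝ), hankelIntegrand z a (x + -I) := by
    congr 1
    ext x
    rw [hankelBranch_I_eq (fun h => by simpa using congrArg im h) (by simp), ofReal_neg, ofReal_one,
      neg_one_mul]
  have e3 : ∫ y in (0 : ℝ)..1, hankelBranch (-I) z a (-1 + y * I)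
      = ∫ y in (0 : ℝ)..1, hankelIntegrand z a (-1 + y * I) := by
    refine intervalIntegral.integral_congr fun y hy => ?_
    rw [uIcc_of_le zero_le_one] at hy
    exact hankelBranch_neg_I_eq (Or.inr (by simpa using hy.1))
  have e4 : ∫ y in (-1 : ℝ)..0, hankelBranch I z a (-1 + y * I)
      = ∫ y in (-1 : ℝ)..0, hankelIntegrand z a (-1 + y * I) := by
    refine intervalIntegral.integral_congr fun y hy => ?_
    rw [uIcc_of_le (by norm_num)] at hy
    exact hankelBranch_I_eq (fun h => by simpa using congrArg re h) (by simpa using hy.2)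
  have hi := fun y₁ y₂ => (continuous_hankelIntegrand_vertical' z a).intervalIntegrable
    (μ := volume) y₁ y₂
  have e5 := intervalIntegral.integral_add_adjacent_intervals (hi (-1) 0) (hi 0 1)
  -- The two branches agree on (-1, 0]; on x > 0 they are exp(±iπa) x^a, whose difference gives 2i
  -- sin(πa).
  have e6 : (∫ x in Ioi (-1 : ℝ), hankelBranch I z a x)
      - (∫ x in Ioi (-1 : ℝ), hankelBranch (-I) z a x) = 2 * I * sin (Real.pi * a) *
      ∫ x in Ioi (0 : ℝ), exp (-z * x - (x : ℂ) ^ 2 / 2) * (x : ℂ) ^ a := by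
    have hint : ∀ u : ℂ, (u = I ∨ u = -I) →
        IntegrableOn (fun x : ℝ => hankelBranch u z a x) (Ioi (-1)) := by
      intro u hu
      obtain ⟨C, hC⟩ := exists_bound_hankelBranch (u := u) (by rcases hu with rfl | rfl <;> simp) z ha
      refine Integrable.mono' ((integrableOn_exp_neg_Ioi (-1)).const_mul C) ?_
        (ae_of_all _ fun x => by simpa using hC x (by simp))
      refine Continuous.aestronglyMeasurable (continuous_iff_continuousAt.2 fun x => ?_)
      exact ContinuousAt.comp (f := fun x : ℝ => (x : ℂ)) (continuousAt_hankelBranch ha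
        (by rcases hu with rfl | rfl <;> simp)) (by fun_prop)
    rw [← integral_sub (hint I (Or.inl rfl)) (hint (-I) (Or.inr rfl)), ← integral_const_mul,
      setIntegral_eq_of_subset_of_forall_sdiff_eq_zero measurableSet_Ioi
        (Ioi_subset_Ioi (show (-1 : ℝ) ≤ 0 by norm_num)) (fun x hx => ?_)]
    swap
    · rcases (notMem_Ioi.1 hx.2).lt_or_eq with h | rfl
      · rw [hankelBranch_I_eq (ofReal_ne_zero.2 h.ne) (by simp),
          hankelBranch_neg_I_eq (Or.inr (by simpa using h)), sub_self]
      · have ha0 : a ≠ 0 := fun h => by simp [h] at ha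
        simp [hankelBranch, zero_cpow ha0]
    refine setIntegral_congr_fun measurableSet_Ioi fun x hx => ?_
    rw [hankelBranch_ofReal I_ne_zero hx, hankelBranch_ofReal (neg_ne_zero.2 I_ne_zero) hx, log_I,
      log_neg_I, sin]
    ring_nf
    rw [I_sq]
    ring_nf
  simp only [ofReal_zero, zero_mul, add_zero] at up down
  rw [loopIntegral_hankelIntegrand, intervalIntegral.integral_symm]
  rw [e1, e3] at up
  rw [e2, e4] at down
  linear_combination e6 + up + down + I * e5

/-! ### The half-line representation and the removable singularities in n. -/

/-- The Hermite function of order `n`, `Re n < -1`, as an integral over the half-line. -/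
def hermiteMellin (n z : ℂ) : ℂ :=
  (Gamma (-n))⁻¹ * ∫ x in Ioi (0 : ℝ), exp (-z * x - (x : ℂ) ^ 2 / 2) * (x : ℂ) ^ (-n - 1)

/-- By the reflection formula, Γ(n+1) Γ(-n) sin(πn) = -π, so the sine from the collapsed loop
cancels. The result is regular at the negative integers n ≤ -2, which is what removes the
singularities there. -/
lemma hermiteContour_eq_hermiteMellin {n : ℂ} (z : ℂ) (hre : n.re < -1)
    (hn : ∀ k : ℕ, n ≠ -((k : ℂ) + 1)) : hermiteContour n z = hermiteMellin n z := by
  have hsin : sin (Real.pi * n) ≠ 0 := by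
    intro h
    obtain ⟨k, hk⟩ := sin_eq_zero_iff.1 h
    have hnk : n = k := by
      have : (Real.pi : ℂ) ≠ 0 := ofReal_ne_zero.2 Real.pi_ne_zero
      exact mul_left_cancel₀ this (by rw [hk, mul_comm])
    have hk1 : k ≤ -1 := by
      rw [hnk, intCast_re] at hre
      exact_mod_cast hre.le
    obtain ⟨m, hm⟩ := Int.eq_ofNat_of_zero_le (show 0 ≤ -k - 1 by omega)
    refine hn m ?_
    have : k = -((m : ℤ) + 1) := by omega
    rw [hnk, this]
    push_cast
    ring
  have hG : Gamma (-n) ≠ 0 := Gamma_ne_zero_of_re_pos (by simp; linarith)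
  have hpi : (Real.pi : ℂ) ≠ 0 := ofReal_ne_zero.2 Real.pi_ne_zero
  have hrefl := Gamma_mul_Gamma_one_sub (-n)
  rw [mul_neg, Complex.sin_neg, sub_neg_eq_add, add_comm (1 : ℂ) n] at hrefl
  have hs2 : sin (Real.pi * (-n - 1)) = sin (Real.pi * n) := by
    rw [show (Real.pi : ℂ) * (-n - 1) = -(Real.pi * n + Real.pi) by ring, Complex.sin_neg,
      Complex.sin_add_pi, neg_neg]
  rw [hermiteContour_eq, loopIntegral_hankelIntegrand_eq z (by simp; linarith), hs2, hermiteMellin]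
  have hG1 : Gamma (n + 1) = -(Real.pi / sin (Real.pi * n)) * (Gamma (-n))⁻¹ := by
    field_simp
    field_simp at hrefl
    linear_combination hrefl
  rw [hG1]
  field_simp [I_ne_zero]

lemma continuousAt_hermiteMellin {n : ℂ} (z : ℂ) (hre : n.re < -1) :
    ContinuousAt (fun m => hermiteMellin m z) n := by
  have hcoef : ContinuousAt (fun m : ℂ => (Gamma (-m))⁻¹) n :=
    (differentiable_one_div_Gamma.continuous.comp continuous_neg).continuousAt
  refine hcoef.mul ?_
  obtain ⟨C, -, hC⟩ := exists_bound_exp_mul_cpow z (‖-n - 1‖ + 1)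
  have hev : ∀ᶠ m : ℂ in 𝓝 n, ‖-m - 1‖ ≤ ‖-n - 1‖ + 1 ∧ 0 ≤ (-m - 1).re := by
    have h1 : ContinuousAt (fun m : ℂ => ‖-m - 1‖) n := by fun_prop
    have h2 : ContinuousAt (fun m : ℂ => (-m - 1).re) n :=
      (continuous_re.comp (by fun_prop : Continuous fun m : ℂ => -m - 1)).continuousAt
    exact (h1.eventually_le_const (lt_add_one _)).and
      (h2.eventually_const_le (by simp; linarith))
  refine continuousAt_of_dominated (bound := fun x => C * Real.exp (-x)) ?_ ?_
    ((integrableOn_exp_neg_Ioi 0).const_mul C) ?_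
  · refine Eventually.of_forall fun m => ContinuousOn.aestronglyMeasurable ?_ measurableSet_Ioi
    refine ContinuousOn.mul (by fun_prop) fun x hx => ?_
    exact (continuousAt_ofReal_cpow_const _ _ (Or.inr (ne_of_gt hx))).continuousWithinAt
  · filter_upwards [hev] with m hm
    refine ae_of_all _ fun x => ?_
    simpa using hC x x (-m - 1) (by simp) rfl hm.1 (Or.inr hm.2)
  · refine (ae_restrict_mem measurableSet_Ioi).mono fun x hx => ?_
    refine ContinuousAt.mul continuousAt_const (ContinuousAt.const_cpow (by fun_prop) (Or.inl ?_))
    exact ofReal_ne_zero.2 (ne_of_gt hx)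

/-- The non-positive integers are the zeros of the entire function 1/Γ, hence isolated. -/
lemma eventually_ne_neg_natCast (n : ℂ) : ∀ᶠ m in 𝓝[≠] n, ∀ k : ℕ, m ≠ -(k : ℂ) := by
  have han : AnalyticOnNhd ℂ (fun s : ℂ => (Gamma s)⁻¹) univ :=
    differentiable_one_div_Gamma.differentiableOn.analyticOnNhd isOpen_univ
  rcases (han n (mem_univ n)).eventually_eq_zero_or_eventually_ne_zero with h | h
  · have h1 := han.eqOn_zero_of_preconnected_of_eventuallyEq_zero isPreconnected_univ
      (mem_univ n) h (mem_univ 1)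
    simp at h1
  · filter_upwards [h] with m hm k hk
    exact hm (inv_eq_zero.2 ((Gamma_eq_zero_iff m).2 ⟨k, hk⟩))

lemma tendsto_add_const_punctured (n c : ℂ) :
    Tendsto (fun m => m + c) (𝓝[≠] n) (𝓝[≠] (n + c)) := by
  refine tendsto_nhdsWithin_of_tendsto_nhds_of_eventually_within _ ?_ ?_
  · exact ((continuous_add_const c).tendsto n).mono_left nhdsWithin_le_nhds
  · filter_upwards [self_mem_nhdsWithin] with m hm h
    exact hm (add_right_cancel h)

lemma tendsto_hermiteContour_hermiteMellin {n : ℂ} (z : ℂ) (hre : n.re < -1) :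
    Tendsto (fun m => hermiteContour m z) (𝓝[≠] n) (𝓝 (hermiteMellin n z)) := by
  refine ((continuousAt_hermiteMellin z hre).tendsto.mono_left nhdsWithin_le_nhds).congr' ?_
  have hopen : ∀ᶠ m : ℂ in 𝓝[≠] n, m.re < -1 :=
    nhdsWithin_le_nhds ((isOpen_lt continuous_re continuous_const).mem_nhds hre)
  filter_upwards [hopen, eventually_ne_neg_natCast n] with m hm hk
  exact (hermiteContour_eq_hermiteMellin z hm fun k => by exact_mod_cast hk (k + 1)).symm

lemma eventually_hermiteContour_recurrence (n z : ℂ) : ∀ᶠ m in 𝓝[≠] n,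
    hermiteContour (m + 1) z = z * hermiteContour m z - m * hermiteContour (m + -1) z := by
  filter_upwards [eventually_ne_neg_natCast n] with m hk
  exact hermiteContour_recurrence z hk

/-- Existence of this limit is what gives the `limUnder` in `hermiteHe` its intended value. -/
lemma tendsto_hermiteContour (n z : ℂ) :
    Tendsto (fun m => hermiteContour m z) (𝓝[≠] n) (𝓝 (hermiteHe n z)) := by
  by_cases h : ∃ k : ℕ, n = -((k : ℂ) + 1)
  · rw [hermiteHe, if_pos h]
    refine tendsto_nhds_limUnder ?_
    obtain ⟨k, rfl⟩ := h
    rcases k.eq_zero_or_pos with rfl | hk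
    -- The order -1 is outside Re n < -1; the recurrence centred at -2 expresses it through the
    -- orders -2 and -3, where the half-line integral is available.
    · have t0 : Tendsto (fun m : ℂ => m) (𝓝[≠] (-2)) (𝓝 (-2)) := nhdsWithin_le_nhds
      have t1 := tendsto_hermiteContour_hermiteMellin (n := -2) z (by norm_num)
      have t2 := (tendsto_hermiteContour_hermiteMellin (n := -2 + -1) z (by norm_num)).comp
        (tendsto_add_const_punctured (-2) (-1))
      have t3 := ((t1.const_mul z).sub (t0.mul t2)).congr' (by
        filter_upwards [eventually_hermiteContour_recurrence (-2) z] with m hm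
        exact hm.symm)
      have e : (-((0 : ℕ) + 1 : ℂ)) + -1 = -2 := by norm_num
      refine ⟨_, Tendsto.congr (fun m => ?_) (t3.comp (e ▸ tendsto_add_const_punctured _ (-1)))⟩
      simp
    · refine ⟨_, tendsto_hermiteContour_hermiteMellin z ?_⟩
      have : (1 : ℝ) ≤ k := by exact_mod_cast hk
      simp
      linarith
  · rw [hermiteHe, if_neg h]
    exact (continuousAt_hermiteContour z (not_exists.1 h)).tendsto.mono_left nhdsWithin_le_nhds

lemma hermiteHe_eq_hermiteMellin {n : ℂ} (z : ℂ) (hre : n.re < -1) :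
    hermiteHe n z = hermiteMellin n z :=
  tendsto_nhds_unique (tendsto_hermiteContour n z) (tendsto_hermiteContour_hermiteMellin z hre)

/-- The three-term recurrence for Hermite functions. -/
lemma hermiteHe_add_one (n z : ℂ) :
    hermiteHe (n + 1) z = z * hermiteHe n z - n * hermiteHe (n - 1) z := by
  have t0 : Tendsto (fun m : ℂ => m) (𝓝[≠] n) (𝓝 n) := nhdsWithin_le_nhds
  have t1 := (tendsto_hermiteContour (n + 1) z).comp (tendsto_add_const_punctured n 1)
  have t2 := (tendsto_hermiteContour (n + -1) z).comp (tendsto_add_const_punctured n (-1))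
  exact tendsto_nhds_unique t1 ((((tendsto_hermiteContour n z).const_mul z).sub
    (t0.mul t2)).congr' (by
      filter_upwards [eventually_hermiteContour_recurrence n z] with m hm
      exact hm.symm))

/-! ### Rotation of the ray of integration. -/

lemma integrableOn_rpow_mul_exp_neg {s b : ℝ} (hs : -1 < s) (hb : 0 < b) :
    IntegrableOn (fun t : ℝ => t ^ s * Real.exp (-b * t)) (Ioi 0) := by
  simpa using integrableOn_rpow_mul_exp_neg_mul_rpow hs one_pos hb

lemma integrableOn_cpow_mul_of_norm_le {a : ℂ} (ha : -1 < a.re) {f : ℝ → ℂ} (hf : Continuous f)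
    {C b : ℝ} (hb : 0 < b) (hC : ∀ t, 0 < t → ‖f t‖ ≤ C * Real.exp (-b * t)) :
    IntegrableOn (fun t : ℝ => (t : ℂ) ^ a * f t) (Ioi 0) := by
  refine Integrable.mono' ((integrableOn_rpow_mul_exp_neg ha hb).const_mul C) ?_ ?_
  · refine ContinuousOn.aestronglyMeasurable (fun t ht => ?_) measurableSet_Ioi
    exact ((continuousAt_ofReal_cpow_const _ _ (Or.inr (ne_of_gt ht))).mul
      hf.continuousAt).continuousWithinAt
  · refine (ae_restrict_mem measurableSet_Ioi).mono fun t ht => ?_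
    rw [norm_mul, norm_cpow_eq_rpow_re_of_pos ht]
    calc t ^ a.re * ‖f t‖ ≤ t ^ a.re * (C * Real.exp (-b * t)) :=
          mul_le_mul_of_nonneg_left (hC t ht) (Real.rpow_nonneg (le_of_lt ht) _)
      _ = _ := by ring

/-- Rotation of the ray of integration in a Mellin integral: `c^a ∫ t^(a-1) G(ct) dt` does not
depend on `c`. -/
lemma cpow_mul_mellin_eq_of_rotation {G G' : ℂ → ℂ} (hG : ∀ w, HasDerivAt G (G' w) w)
    (hGd : Continuous G') {S : Set ℂ} (hSo : IsOpen S) (hSc : IsPreconnected S)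
    (hS : S ⊆ slitPlane)
    (hb : ∀ c₀ ∈ S, ∃ C b : ℝ, 0 < b ∧ ∀ᶠ c in 𝓝 c₀, ∀ t : ℝ, 0 < t →
      ‖G (c * t)‖ ≤ C * Real.exp (-b * t) ∧ ‖G' (c * t)‖ ≤ C * Real.exp (-b * t))
    {a : ℂ} (ha : 0 < a.re) {c c' : ℂ} (hc : c ∈ S) (hc' : c' ∈ S) :
    c ^ a * ∫ t in Ioi (0 : ℝ), (t : ℂ) ^ (a - 1) * G (c * t) =
      c' ^ a * ∫ t in Ioi (0 : ℝ), (t : ℂ) ^ (a - 1) * G (c' * t) := by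
  have hGc : Continuous G := continuous_iff_continuousAt.2 fun w => (hG w).continuousAt
  have ha0 : a ≠ 0 := fun h => by simp [h] at ha
  -- The derivative in c is c^(a-1) times the integral of d/dt [t^a G(ct)], and the boundary terms
  -- vanish at 0 (as Re a > 0) and at ∞.
  have hder : ∀ c₀ ∈ S, HasDerivAt
      (fun c : ℂ => c ^ a * ∫ t in Ioi (0 : ℝ), (t : ℂ) ^ (a - 1) * G (c * t)) 0 c₀ := by
    intro c₀ hc₀
    obtain ⟨C, b, hb0, hbound⟩ := hb c₀ hc₀
    have hI : ∀ f : ℂ → ℂ, Continuous f → (∀ t : ℝ, 0 < t → ‖f (c₀ * t)‖ ≤ C * Real.exp (-b * t)) →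
        ∀ s : ℂ, -1 < s.re → IntegrableOn (fun t : ℝ => (t : ℂ) ^ s * f (c₀ * t)) (Ioi 0) :=
      fun f hf hle s hs => integrableOn_cpow_mul_of_norm_le hs (by fun_prop) hb0 hle
    have h0 := hbound.self_of_nhds
    have i1 := hI G hGc (fun t ht => (h0 t ht).1) (a - 1) (by simpa using ha)
    have i2 := hI G' hGd (fun t ht => (h0 t ht).2) a (by linarith)
    have hmeas : ∀ (f : ℂ → ℂ) (hf : Continuous f) (s c : ℂ), AEStronglyMeasurable
        (fun t : ℝ => (t : ℂ) ^ s * f (c * t)) (volume.restrict (Ioi 0)) := by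
      intro f hf s c
      refine ContinuousOn.aestronglyMeasurable (fun t ht => ?_) measurableSet_Ioi
      exact ((continuousAt_ofReal_cpow_const _ _ (Or.inr (ne_of_gt ht))).mul
        (by fun_prop)).continuousWithinAt
    have hd := (hasDerivAt_integral_of_dominated_loc_of_deriv_le (μ := volume.restrict (Ioi 0))
      (F := fun (c : ℂ) (t : ℝ) => (t : ℂ) ^ (a - 1) * G (c * t))
      (F' := fun (c : ℂ) (t : ℝ) => (t : ℂ) ^ a * G' (c * t)) (x₀ := c₀)
      (bound := fun t => C * (t ^ a.re * Real.exp (-b * t))) hbound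
      (Eventually.of_forall fun c => hmeas G hGc _ _) i1 (hmeas G' hGd _ _) ?_
      ((integrableOn_rpow_mul_exp_neg (by linarith) hb0).const_mul C) ?_).2
    · have hparts : a * (∫ t in Ioi (0 : ℝ), (t : ℂ) ^ (a - 1) * G (c₀ * t))
          + c₀ * (∫ t in Ioi (0 : ℝ), (t : ℂ) ^ a * G' (c₀ * t)) = 0 := by
        rw [← integral_const_mul, ← integral_const_mul, ← integral_add (i1.const_mul a)
          (i2.const_mul c₀)]
        have hcont0 : ContinuousAt (fun t : ℝ => (t : ℂ) ^ a * G (c₀ * t)) 0 :=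
          (continuousAt_ofReal_cpow_const _ _ (Or.inl ha)).mul (by fun_prop)
        have := integral_Ioi_of_hasDerivAt_of_tendsto (a := 0) (m := 0)
          (f := fun t : ℝ => (t : ℂ) ^ a * G (c₀ * t))
          (f' := fun t : ℝ => a * ((t : ℂ) ^ (a - 1) * G (c₀ * t))
            + c₀ * ((t : ℂ) ^ a * G' (c₀ * t))) hcont0.continuousWithinAt (fun t ht => ?_)
          ((i1.const_mul a).add (i2.const_mul c₀)) ?_
        · simpa [zero_cpow ha0] using this
        · have d1 : HasDerivAt (fun t : ℂ => t ^ a) (a * (t : ℂ) ^ (a - 1) * 1) (t : ℂ) :=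
            (hasDerivAt_id (t : ℂ)).cpow_const (Or.inl (by simpa using ht))
          have d2 : HasDerivAt (fun t : ℂ => G (c₀ * t)) (G' (c₀ * t) * (c₀ * 1)) (t : ℂ) :=
            (hG (c₀ * t)).comp (t : ℂ) ((hasDerivAt_id (t : ℂ)).const_mul c₀)
          refine ((d1.mul d2).comp_ofReal).congr_deriv ?_
          ring
        · refine squeeze_zero_norm' (a := fun t : ℝ => C * (t ^ a.re * Real.exp (-b * t))) ?_ ?_
          · filter_upwards [eventually_gt_atTop 0] with t ht
            rw [norm_mul, norm_cpow_eq_rpow_re_of_pos ht]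
            calc t ^ a.re * ‖G (c₀ * t)‖ ≤ t ^ a.re * (C * Real.exp (-b * t)) :=
                  mul_le_mul_of_nonneg_left (h0 t ht).1 (Real.rpow_nonneg (le_of_lt ht) _)
              _ = _ := by ring
          · simpa using (tendsto_rpow_mul_exp_neg_mul_atTop_nhds_zero a.re b hb0).const_mul C
      have hc0 : c₀ ≠ 0 := slitPlane_ne_zero (hS hc₀)
      have hpow : HasDerivAt (fun c : ℂ => c ^ a) (a * c₀ ^ (a - 1) * 1) c₀ :=
        (hasDerivAt_id c₀).cpow_const (hS hc₀)
      refine (hpow.mul hd).congr_deriv ?_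
      have : c₀ ^ a = c₀ ^ (a - 1) * c₀ := by
        rw [cpow_sub _ _ hc0, cpow_one, div_mul_cancel₀ _ hc0]
      rw [this]
      linear_combination c₀ ^ (a - 1) * hparts
    · refine (ae_restrict_mem measurableSet_Ioi).mono fun t ht c hc => ?_
      rw [norm_mul, norm_cpow_eq_rpow_re_of_pos ht]
      calc t ^ a.re * ‖G' (c * t)‖ ≤ t ^ a.re * (C * Real.exp (-b * t)) :=
            mul_le_mul_of_nonneg_left (hc t ht).2 (Real.rpow_nonneg (le_of_lt ht) _)
        _ = _ := by ring
    · refine (ae_restrict_mem measurableSet_Ioi).mono fun t ht c _ => ?_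
      have ht0 : (t : ℂ) ≠ 0 := ofReal_ne_zero.2 (ne_of_gt ht)
      have d2 : HasDerivAt (fun c : ℂ => G (c * t)) (G' (c * t) * (1 * t)) c :=
        (hG (c * t)).comp c ((hasDerivAt_id c).mul_const (t : ℂ))
      refine (d2.const_mul _).congr_deriv ?_
      rw [cpow_sub _ _ ht0, cpow_one]
      field_simp
  exact hSo.is_const_of_deriv_eq_zero hSc
    (fun c hc => (hder c hc).differentiableAt.differentiableWithinAt)
    (fun c hc => (hder c hc).deriv) hc hc'

/-- The Gamma integral with a complex rate. -/
lemma integral_cpow_mul_exp_neg_mul_complex {a w : ℂ} (ha : 0 < a.re) (hw : 0 < w.re) :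
    w ^ a * ∫ t in Ioi (0 : ℝ), (t : ℂ) ^ (a - 1) * exp (-(w * t)) = Gamma a := by
  have := cpow_mul_mellin_eq_of_rotation (G := fun w => exp (-w)) (G' := fun w => -exp (-w))
    (S := {c : ℂ | 0 < c.re}) (fun w => ?_) (by fun_prop)
    (isOpen_lt continuous_const continuous_re) (convex_halfSpace_re_gt 0).isPreconnected
    (fun c hc => Or.inl hc) (fun c₀ hc₀ => ?_) ha (c := w) (c' := 1) hw (by simp)
  · rw [this, one_cpow, one_mul]
    have h1 := integral_cpow_mul_exp_neg_mul_Ioi (r := 1) ha one_pos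
    simpa using h1
  · simpa using (hasDerivAt_id w).neg.cexp
  · have hc0 : 0 < c₀.re := hc₀
    refine ⟨1, c₀.re / 2, by positivity, ?_⟩
    have hev : ∀ᶠ c : ℂ in 𝓝 c₀, c₀.re / 2 < c.re :=
      (isOpen_lt continuous_const continuous_re).mem_nhds (by simpa using hc0)
    filter_upwards [hev] with c hc t ht
    have : ‖exp (-(c * t))‖ ≤ 1 * Real.exp (-(c₀.re / 2) * t) := by
      rw [norm_exp, one_mul, Real.exp_le_exp]
      simp only [neg_re, mul_re, ofReal_re, ofReal_im, mul_zero, sub_zero]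
      nlinarith
    exact ⟨this, by simpa using this⟩

/-- Rotation of the ray of integration for the Hermite function. -/
lemma hermiteMellin_eq_rotated {n : ℂ} (z : ℂ) (hn : n.re < 0) {c : ℂ} (hc : |c.im| < c.re) :
    hermiteMellin n z = (Gamma (-n))⁻¹ * (c ^ (-n) *
      ∫ t in Ioi (0 : ℝ), (t : ℂ) ^ (-n - 1) * exp (-z * (c * t) - (c * t) ^ 2 / 2)) := by
  -- The set S is the sector |arg c| < π/4, where Re c² > 0 and the Gaussian still decays along the
  -- ray.
  have := cpow_mul_mellin_eq_of_rotation (G := fun w => exp (-z * w - w ^ 2 / 2))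
    (G' := fun w => exp (-z * w - w ^ 2 / 2) * (-z - w))
    (S := {c : ℂ | |c.im| < c.re}) (fun w => ?_) (by fun_prop)
    (isOpen_lt (by fun_prop) continuous_re) ?_
    (fun c hc => Or.inl ((abs_nonneg _).trans_lt hc)) (fun c₀ hc₀ => ?_)
    (a := -n) (by simpa using hn) (c := c) (c' := 1) hc (by simp)
  · rw [this, hermiteMellin, one_cpow, one_mul]
    simp only [one_mul, mul_comm ((_ : ℂ) ^ (-n - 1))]
  · have : HasDerivAt (fun t : ℂ => -z * t - t ^ 2 / 2) (-z - w) w := by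
      refine (((hasDerivAt_id' w).const_mul (-z)).sub
        ((hasDerivAt_pow 2 w).div_const 2)).congr_deriv ?_
      push_cast
      ring
    exact this.cexp
  · have hconv : Convex ℝ {c : ℂ | |c.im| < c.re} := by
      have : {c : ℂ | |c.im| < c.re} = {c : ℂ | 0 < (c.re - c.im)} ∩ {c : ℂ | 0 < c.re + c.im} := by
        ext c
        simp only [mem_ofPred_eq, mem_inter_iff, abs_lt]
        constructor <;> intro h <;> constructor <;> linarith [h.1, h.2]
      rw [this]
      exact (convex_halfSpace_gt ((reLm - imLm).isLinear) 0).inter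
        (convex_halfSpace_gt ((reLm + imLm).isLinear) 0)
    exact hconv.isPreconnected
  · have hc0 : |c₀.im| < c₀.re := hc₀
    have hsq : 0 < (c₀ ^ 2).re := by
      rw [pow_two, mul_re]
      nlinarith [abs_lt.1 hc0]
    set η := (c₀ ^ 2).re / 2 with hη
    have hη0 : 0 < η := by positivity
    set B := ‖c₀‖ + 1
    have hev1 : ∀ᶠ c : ℂ in 𝓝 c₀, η < (c ^ 2).re :=
      (isOpen_lt continuous_const (by fun_prop)).mem_nhds (by
        simp only [mem_ofPred_eq]; linarith)
    have hev2 : ∀ᶠ c : ℂ in 𝓝 c₀, ‖c‖ < B :=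
      (isOpen_lt (by fun_prop) continuous_const).mem_nhds (lt_add_one ‖c₀‖)
    -- The slope M collects ‖z‖B from the linear exponent, B from the factor -z - ct of the
    -- derivative and 1 for the decay `exp (-t)`; completing the square against η t²/2 bounds the
    -- rest.
    set M := ‖z‖ * B + B + 1 with hM
    refine ⟨Real.exp (‖z‖ + M ^ 2 / (2 * η)), 1, one_pos, ?_⟩
    filter_upwards [hev1, hev2] with c h1 h2 t ht
    have hq : M * t - η * t ^ 2 / 2 ≤ M ^ 2 / (2 * η) := by
      rw [le_div_iff₀ (by positivity)]
      nlinarith [sq_nonneg (η * t - M)]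
    have hre : (-z * (c * t) - (c * t) ^ 2 / 2).re ≤ ‖z‖ * B * t - η * t ^ 2 / 2 := by
      have e1 : (-z * (c * t)).re ≤ ‖z‖ * B * t := by
        refine (re_le_norm _).trans ?_
        rw [norm_mul, norm_mul, norm_neg, norm_real, Real.norm_of_nonneg ht.le, ← mul_assoc]
        gcongr
      have e2 : ((c * t) ^ 2 / 2 : ℂ).re = (c ^ 2).re * t ^ 2 / 2 := by
        have : ((c * t) ^ 2 / 2 : ℂ) = c ^ 2 * ((t ^ 2 / 2 : ℝ) : ℂ) := by push_cast; ring
        rw [this, re_mul_ofReal]; ring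
      rw [sub_re, e2]
      nlinarith [sq_nonneg t]
    have hz : ‖exp (-z * (c * t) - (c * t) ^ 2 / 2)‖ ≤ Real.exp (‖z‖ * B * t - η * t ^ 2 / 2) := by
      rw [norm_exp]
      exact Real.exp_le_exp.2 hre
    have hB : 0 ≤ B := by positivity
    constructor
    · refine hz.trans ?_
      rw [← Real.exp_add, Real.exp_le_exp]
      nlinarith [norm_nonneg z, mul_nonneg hB ht.le]
    · have hlin : ‖-z - c * t‖ ≤ Real.exp (‖z‖ + B * t) := by
        calc ‖-z - c * t‖ ≤ ‖-z‖ + ‖c * t‖ := norm_sub_le _ _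
          _ ≤ ‖z‖ + B * t := by
            rw [norm_neg, norm_mul, norm_real, Real.norm_of_nonneg ht.le]
            gcongr
          _ ≤ _ := by linarith [Real.add_one_le_exp (‖z‖ + B * t)]
      rw [norm_mul]
      refine (mul_le_mul hz hlin (norm_nonneg _) (Real.exp_pos _).le).trans ?_
      rw [← Real.exp_add, ← Real.exp_add, Real.exp_le_exp]
      nlinarith [norm_nonneg z, mul_nonneg hB ht.le]

/-! ### Watson's lemma and the expansion for Re n < 0. -/

/-- Each Taylor remainder is the derivative of the next, so the mean value inequality on a convex
half-disc raises the order. The half-plane avoids a factor exp ‖x‖, so the bound can be integrated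
over the whole ray. -/
lemma norm_exp_sub_sum_le_of_re_nonpos (K : ℕ) {x : ℂ} (hx : x.re ≤ 0) :
    ‖exp x - ∑ k ∈ Finset.range K, x ^ k / (k ! : ℂ)‖ ≤ ‖x‖ ^ K := by
  induction K generalizing x with
  | zero => simpa [norm_exp] using hx
  | succ K ih =>
    have hd : ∀ y : ℂ, HasDerivAt
        (fun y => exp y - ∑ k ∈ Finset.range (K + 1), y ^ k / (k ! : ℂ))
        (exp y - ∑ k ∈ Finset.range K, y ^ k / (k ! : ℂ)) y := by
      intro y
      refine (hasDerivAt_exp y).sub ?_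
      simp only [Finset.sum_range_succ' _ K, pow_zero]
      refine HasDerivAt.add_const _ (HasDerivAt.fun_sum (u := Finset.range K)
        (A := fun k (y : ℂ) => y ^ (k + 1) / ((k + 1)! : ℂ)) fun k _ => ?_)
      refine ((hasDerivAt_pow (k + 1) y).div_const _).congr_deriv ?_
      rw [Nat.factorial_succ]
      have h1 : (k ! : ℂ) ≠ 0 := by exact_mod_cast k.factorial_ne_zero
      have h2 : (k : ℂ) + 1 ≠ 0 := by exact_mod_cast k.succ_ne_zero
      push_cast
      field_simp
    have hconv : Convex ℝ ({y : ℂ | y.re ≤ 0} ∩ Metric.closedBall 0 ‖x‖) :=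
      (convex_halfSpace_re_le 0).inter (convex_closedBall _ _)
    have := hconv.norm_image_sub_le_of_norm_hasDerivWithin_le (C := ‖x‖ ^ K)
      (fun y _ => (hd y).hasDerivWithinAt) (fun y hy => (ih hy.1).trans ?_)
      (x := 0) (y := x) (by simp) (by simpa using hx)
    · simpa [Finset.sum_range_succ', pow_succ] using this
    · have : ‖y‖ ≤ ‖x‖ := by simpa using hy.2
      gcongr

/-- **Watson's lemma** for `exp (-q t²)`, with an explicit remainder. -/
lemma norm_integral_sub_sum_le {a w q : ℂ} (ha : 0 < a.re) (hw : 0 < w.re) (hq : 0 ≤ q.re) (K : ℕ) :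
    ‖(∫ t in Ioi (0 : ℝ), (t : ℂ) ^ (a - 1) * exp (-(w * t) - q * t ^ 2)) -
      ∑ k ∈ Finset.range K, (-q) ^ k / (k ! : ℂ) * (Gamma (a + 2 * k) * w ^ (-(a + 2 * k)))‖ ≤
      ‖q‖ ^ K * ((1 / w.re) ^ (a.re + 2 * K) * Real.Gamma (a.re + 2 * K)) := by
  have hnorm : ∀ t : ℝ, 0 < t → ‖exp (-(w * t))‖ = Real.exp (-w.re * t) := by
    intro t _
    rw [norm_exp]
    simp
  have hpow : ∀ t : ℝ, 0 < t → ∀ k : ℕ,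
      (t : ℂ) ^ (a + 2 * k - 1) = (t : ℂ) ^ (a - 1) * (t : ℂ) ^ (2 * k) := by
    intro t ht k
    rw [show a + 2 * k - 1 = a - 1 + (2 * k : ℕ) by push_cast; ring,
      cpow_add _ _ (ofReal_ne_zero.2 ht.ne'), cpow_natCast]
  have hre : ∀ k : ℕ, (a + 2 * k).re = a.re + 2 * k := by intro k; simp
  have hrepos : ∀ k : ℕ, 0 < a.re + 2 * k := fun k => by positivity
  have hk : ∀ k : ℕ, (-q) ^ k / (k ! : ℂ) * (Gamma (a + 2 * k) * w ^ (-(a + 2 * k))) =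
      ∫ t in Ioi (0 : ℝ), (-q) ^ k / (k ! : ℂ) * ((t : ℂ) ^ (a + 2 * k - 1) * exp (-(w * t))) := by
    intro k
    rw [integral_const_mul]
    congr 1
    have hw0 : w ≠ 0 := fun h => by simp [h] at hw
    rw [← integral_cpow_mul_exp_neg_mul_complex (by rw [hre]; exact hrepos k) hw, cpow_neg,
      mul_comm, inv_mul_cancel_left₀]
    simp [cpow_eq_zero_iff, hw0]
  have hint : ∀ k : ℕ, IntegrableOn (fun t : ℝ => (-q) ^ k / (k ! : ℂ) *
      ((t : ℂ) ^ (a + 2 * k - 1) * exp (-(w * t)))) (Ioi 0) := fun k =>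
    (integrableOn_cpow_mul_of_norm_le (by
      have := hrepos k
      rw [sub_re, hre, one_re]
      linarith) (by fun_prop) hw (C := 1) fun t ht => by rw [hnorm t ht, one_mul]).const_mul _
  have hint0 : IntegrableOn (fun t : ℝ => (t : ℂ) ^ (a - 1) * exp (-(w * t) - q * t ^ 2))
      (Ioi 0) := by
    refine integrableOn_cpow_mul_of_norm_le (by rw [sub_re, one_re]; linarith)
      (by fun_prop) hw (C := 1) fun t ht => ?_
    rw [norm_exp, one_mul, Real.exp_le_exp]
    have : (q * (t : ℂ) ^ 2).re = q.re * t ^ 2 := by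
      rw [← ofReal_pow, re_mul_ofReal]
    rw [sub_re, this]
    simp only [neg_re, mul_re, ofReal_re, ofReal_im, mul_zero, sub_zero]
    nlinarith [mul_nonneg hq (sq_nonneg t)]
  rw [Finset.sum_congr rfl fun k _ => hk k, ← integral_finsetSum _ fun k _ => hint k,
    ← integral_sub hint0 (integrable_finsetSum _ fun k _ => hint k)]
  have hG := Real.integral_rpow_mul_exp_neg_mul_Ioi (hrepos K) hw
  rw [← hG, ← integral_const_mul]
  have hintR : IntegrableOn (fun t : ℝ => t ^ (a.re + 2 * K - 1) * Real.exp (-(w.re * t)))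
      (Ioi 0) := by
    have := integrableOn_rpow_mul_exp_neg (s := a.re + 2 * K - 1) (b := w.re)
      (by linarith [hrepos K]) hw
    simpa only [neg_mul] using this
  refine norm_integral_le_of_norm_le (hintR.const_mul _) ?_
  refine (ae_restrict_mem measurableSet_Ioi).mono fun t ht => ?_
  have ht0 : (0 : ℝ) < t := ht
  -- The error integrand is a Taylor remainder of exp(-qt²), at most (‖q‖ t²)^K since Re q ≥ 0; what
  -- remains is a real Gamma integral.
  have e : (t : ℂ) ^ (a - 1) * exp (-(w * t) - q * t ^ 2) - ∑ k ∈ Finset.range K,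
      (-q) ^ k / (k ! : ℂ) * ((t : ℂ) ^ (a + 2 * k - 1) * exp (-(w * t))) =
      (t : ℂ) ^ (a - 1) * exp (-(w * t)) *
        (exp (-q * t ^ 2) - ∑ k ∈ Finset.range K, (-q * t ^ 2) ^ k / (k ! : ℂ)) := by
    rw [mul_sub, Finset.mul_sum, mul_assoc, ← exp_add]
    congr 1
    · congr 2; ring
    · refine Finset.sum_congr rfl fun k _ => ?_
      rw [hpow t ht k, mul_pow, pow_mul]
      ring
  have hx : (-q * (t : ℂ) ^ 2).re ≤ 0 := by
    rw [← ofReal_pow, re_mul_ofReal, neg_re]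
    nlinarith [mul_nonneg hq (sq_nonneg t)]
  rw [e, norm_mul, norm_mul, hnorm t ht, norm_cpow_eq_rpow_re_of_pos ht0]
  calc _ ≤ t ^ (a - 1).re * Real.exp (-w.re * t) * ‖-q * (t : ℂ) ^ 2‖ ^ K := by
        gcongr
        exact norm_exp_sub_sum_le_of_re_nonpos K hx
    _ = ‖q‖ ^ K * ((t ^ (a.re - 1) * t ^ (2 * K)) * Real.exp (-(w.re * t))) := by
        rw [norm_mul, norm_neg, norm_pow, norm_real, Real.norm_of_nonneg ht0.le, sub_re, one_re,
          mul_pow, pow_mul, neg_mul]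
        ring
    _ = _ := by
        congr 2
        rw [← Real.rpow_natCast, ← Real.rpow_add ht0]
        congr 1
        push_cast
        ring

lemma Gamma_add_natCast {a : ℂ} (ha : 0 < a.re) (k : ℕ) :
    Gamma (a + k) = (ascPochhammer ℂ k).eval a * Gamma a := by
  induction k with
  | zero => simp
  | succ k ih =>
    have h0 : a + k ≠ 0 := by
      intro h
      have := congrArg re h
      simp only [add_re, natCast_re, zero_re] at this
      have hk : (0 : ℝ) ≤ k := Nat.cast_nonneg k
      linarith
    rw [Nat.cast_succ, ← add_assoc, Gamma_add_one _ h0, ih, ascPochhammer_succ_eval]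
    ring

/-- The formal series `∑ (-1)^k (-n)_{2k} / (2^k k!) X^k`, the asymptotic expansion of
`z^(-n) He_n(z)` in powers of `z⁻²`. -/
def hermiteSeries (n : ℂ) : PowerSeries ℂ :=
  PowerSeries.mk fun k => (-1) ^ k * (ascPochhammer ℂ (2 * k)).eval (-n) / (2 ^ k * (k ! : ℂ))

/-- Along the ray of direction c = exp(iθ) the integral has rate w = zc with Re w ≥ ‖z‖ sin η, so
Watson's lemma applies uniformly. The powers of c in (c²/2)^k w^(-2k) cancel, so the coefficients do
not depend on θ. -/
lemma exists_bound_hermiteMellin_sub_sum {n : ℂ} (hn : n.re < 0) {θ η : ℝ}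
    (hθ : |θ| < Real.pi / 4) (hη : 0 < η) (K : ℕ) :
    ∃ M : ℝ, ∀ z : ℂ, z ≠ 0 → |arg z + θ| ≤ Real.pi / 2 - η →
      ‖z ^ (-n) * hermiteMellin n z -
        ∑ k ∈ Finset.range K, PowerSeries.coeff k (hermiteSeries n) * (z⁻¹ ^ 2) ^ k‖ ≤
      M * ‖z⁻¹ ^ 2‖ ^ K := by
  set c : ℂ := exp (θ * I) with hc
  have hpi := Real.pi_pos
  have hθ' := abs_lt.1 hθ
  have hcnorm : ‖c‖ = 1 := norm_exp_ofReal_mul_I θ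
  have hc0 : c ≠ 0 := exp_ne_zero _
  have hcre : c.re = Real.cos θ := exp_ofReal_mul_I_re θ
  have hcim : c.im = Real.sin θ := exp_ofReal_mul_I_im θ
  have hcarg : arg c = θ := by
    rw [hc, exp_mul_I, arg_cos_add_sin_mul_I ⟨by linarith, by linarith⟩]
  have hcos2 : 0 < Real.cos (2 * θ) := Real.cos_pos_of_mem_Ioo ⟨by linarith, by linarith⟩
  have hcos : 0 < Real.cos θ := Real.cos_pos_of_mem_Ioo ⟨by linarith, by linarith⟩
  have hcS : |c.im| < c.re := by
    rw [hcre, hcim]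
    apply abs_lt_of_sq_lt_sq _ hcos.le
    rw [Real.cos_two_mul'] at hcos2
    linarith
  have hq : 0 ≤ (c ^ 2 / 2).re := by
    have : (c ^ 2 / 2).re = (c.re ^ 2 - c.im ^ 2) / 2 := by
      rw [show (2 : ℂ) = ((2 : ℝ) : ℂ) by norm_num, div_ofReal_re, pow_two, mul_re]; ring
    rw [this, hcre, hcim, ← Real.cos_two_mul']
    positivity
  set a : ℂ := -n with hadef
  have ha : 0 < a.re := by simpa [hadef] using hn
  set κ := Real.sin η with hκ
  have hG0 : Gamma a ≠ 0 := Gamma_ne_zero_of_re_pos ha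
  refine ⟨‖(Gamma a)⁻¹‖ * Real.exp (Real.pi * |a.im|) *
    (‖c ^ 2 / 2‖ ^ K * ((1 / κ) ^ (a.re + 2 * K) * Real.Gamma (a.re + 2 * K))), ?_⟩
  intro z hz harg
  have hη2 : η ≤ Real.pi / 2 := by linarith [abs_nonneg (arg z + θ)]
  have hκ0 : 0 < κ := Real.sin_pos_of_pos_of_lt_pi hη (by linarith)
  have hznorm : 0 < ‖z‖ := norm_pos_iff.2 hz
  have hmem : arg z + arg c ∈ Ioc (-Real.pi) Real.pi := by
    rw [hcarg]
    have := abs_le.1 harg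
    constructor <;> linarith [this.1, this.2]
  have hwre : ‖z‖ * κ ≤ (z * c).re := by
    have h1 : (z * c).re = ‖z‖ * Real.cos (arg z + θ) := by
      have : arg (z * c) = arg z + θ := by
        rw [arg_mul hz hc0 hmem, hcarg]
      rw [← this, ← norm_mul_cos_arg (z * c), norm_mul, hcnorm, mul_one]
    rw [h1]
    gcongr
    rw [hκ, ← Real.cos_pi_div_two_sub, ← Real.cos_abs (arg z + θ)]
    exact Real.cos_le_cos_of_nonneg_of_le_pi (abs_nonneg _) (by linarith) harg
  have hw : 0 < (z * c).re := lt_of_lt_of_le (by positivity) hwre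
  have hw0 : z * c ≠ 0 := mul_ne_zero hz hc0
  have hzc : z ^ a * c ^ a = (z * c) ^ a := (mul_cpow_of_arg_add_arg_mem hz hc0 hmem a).symm
  have hrep : z ^ a * hermiteMellin n z = (Gamma a)⁻¹ * (z * c) ^ a *
      ∫ t in Ioi (0 : ℝ), (t : ℂ) ^ (a - 1) * exp (-(z * c * t) - c ^ 2 / 2 * t ^ 2) := by
    rw [hermiteMellin_eq_rotated z hn hcS, ← hzc]
    have : ∀ t : ℝ, exp (-z * (c * t) - (c * t) ^ 2 / 2) =
        exp (-(z * c * t) - c ^ 2 / 2 * t ^ 2) := by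
      intro t
      congr 1
      ring
    simp only [this]
    ring
  have hsum : ∑ k ∈ Finset.range K, PowerSeries.coeff k (hermiteSeries n) * (z⁻¹ ^ 2) ^ k =
      (Gamma a)⁻¹ * (z * c) ^ a * ∑ k ∈ Finset.range K, (-(c ^ 2 / 2)) ^ k / (k ! : ℂ) *
        (Gamma (a + 2 * k) * (z * c) ^ (-(a + 2 * k))) := by
    rw [Finset.mul_sum]
    refine Finset.sum_congr rfl fun k _ => ?_
    have h1 : (z * c) ^ (-(a + 2 * k)) = ((z * c) ^ a)⁻¹ * ((z * c) ^ (2 * k))⁻¹ := by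
      rw [cpow_neg, cpow_add _ _ hw0, mul_inv]
      congr 2
      exact_mod_cast cpow_natCast (z * c) (2 * k)
    have h2 : Gamma (a + 2 * k) = (ascPochhammer ℂ (2 * k)).eval a * Gamma a := by
      rw [← Gamma_add_natCast ha]
      push_cast
      rfl
    have h3 : (z * c) ^ a ≠ 0 := by simp [cpow_eq_zero_iff, hz, hc0]
    have h4 : (k ! : ℂ) ≠ 0 := by exact_mod_cast k.factorial_ne_zero
    have h5 : (-(c ^ 2 / 2)) ^ k = (-1) ^ k * c ^ (2 * k) / 2 ^ k := by
      rw [neg_pow, div_pow, ← pow_mul, mul_div_assoc]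
    have h6 : (z⁻¹ ^ 2) ^ k = (z ^ (2 * k))⁻¹ := by rw [← pow_mul, inv_pow]
    rw [h1, h2, h5, h6, hermiteSeries, PowerSeries.coeff_mk, mul_pow, ← hadef]
    field_simp
  rw [hrep, hsum, ← mul_sub, norm_mul, norm_mul]
  have hwat := norm_integral_sub_sum_le ha hw hq K
  have hcp : ‖(z * c) ^ a‖ ≤ Real.exp (Real.pi * |a.im|) * ‖z‖ ^ a.re := by
    refine (norm_cpow_le _ _).trans ?_
    rw [norm_mul, hcnorm, mul_one, div_eq_mul_inv, ← Real.exp_neg, mul_comm]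
    gcongr
    calc -(arg (z * c) * a.im) ≤ |arg (z * c) * a.im| := neg_le_abs _
      _ = |arg (z * c)| * |a.im| := abs_mul _ _
      _ ≤ _ := by gcongr; exact abs_arg_le_pi _
  have hs : 0 < a.re + 2 * K := by positivity
  have hGpos : 0 < Real.Gamma (a.re + 2 * K) := Real.Gamma_pos_of_pos hs
  have hrp : (1 / (z * c).re) ^ (a.re + 2 * K) ≤
      (1 / κ) ^ (a.re + 2 * K) * (‖z‖ ^ a.re)⁻¹ * ‖z⁻¹ ^ 2‖ ^ K := by
    calc (1 / (z * c).re) ^ (a.re + 2 * K) ≤ (1 / (‖z‖ * κ)) ^ (a.re + 2 * K) := by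
          gcongr
      _ = _ := by
        rw [mul_comm ‖z‖ κ, one_div, mul_inv, ← one_div κ, Real.mul_rpow (by positivity)
          (by positivity), mul_assoc]
        congr 1
        rw [Real.rpow_add (by positivity), Real.inv_rpow hznorm.le]
        congr 1
        rw [norm_pow, norm_inv, ← pow_mul]
        exact_mod_cast Real.rpow_natCast ‖z‖⁻¹ (2 * K)
  have hzp : 0 < ‖z‖ ^ a.re := Real.rpow_pos_of_pos hznorm _
  calc _ ≤ ‖(Gamma a)⁻¹‖ * (Real.exp (Real.pi * |a.im|) * ‖z‖ ^ a.re) *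
        (‖c ^ 2 / 2‖ ^ K * (((1 / κ) ^ (a.re + 2 * K) * (‖z‖ ^ a.re)⁻¹ * ‖z⁻¹ ^ 2‖ ^ K) *
          Real.Gamma (a.re + 2 * K))) := by
        gcongr
        exact hwat.trans (by gcongr)
    _ = _ := by
        field_simp

/-! ### Algebra of asymptotic series. -/

/-- `f` has the asymptotic expansion `∑ p_m u^m` along the filter `l`. -/
def HasAsympSeries {α : Type*} (l : Filter α) (u f : α → ℂ) (p : PowerSeries ℂ) : Prop :=
  ∀ N : ℕ, (fun x => f x - ∑ m ∈ Finset.range N, PowerSeries.coeff m p * u x ^ m) =O[l]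
    fun x => u x ^ N

namespace HasAsympSeries

variable {α : Type*} {l : Filter α} {u f g : α → ℂ} {p q : PowerSeries ℂ}

lemma eval_trunc (N : ℕ) (p : PowerSeries ℂ) (x : ℂ) :
    (p.trunc N).eval x = ∑ m ∈ Finset.range N, PowerSeries.coeff m p * x ^ m := by
  rw [← Polynomial.eval₂_id, PowerSeries.eval₂_trunc_eq_sum_range]
  simp

lemma isBigO_eval_of_X_pow_dvd (hu : u =O[l] fun _ => (1 : ℂ)) {N : ℕ} {r : Polynomial ℂ}
    (hr : Polynomial.X ^ N ∣ r) : (fun x => r.eval (u x)) =O[l] fun x => u x ^ N := by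
  obtain ⟨s, rfl⟩ := hr
  have hs : (fun x => s.eval (u x)) =O[l] fun _ => (1 : ℂ) := by
    simp only [Polynomial.eval_eq_sum_range]
    refine IsBigO.fun_sum fun i _ => ?_
    simpa using (hu.pow i).const_mul_left (s.coeff i)
  simpa using (isBigO_refl (fun x => u x ^ N) l).mul hs

lemma congr' (h : HasAsympSeries l u f p) (hfg : f =ᶠ[l] g) : HasAsympSeries l u g p :=
  fun N => (h N).congr' (by filter_upwards [hfg] with x hx; rw [hx]) EventuallyEq.rfl

lemma comp_tendsto {β : Type*} {l' : Filter β} {k : β → α} (h : HasAsympSeries l u f p)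
    (hk : Tendsto k l' l) : HasAsympSeries l' (u ∘ k) (f ∘ k) p :=
  fun N => (h N).comp_tendsto hk

lemma isBigO_one (h : HasAsympSeries l u f p) : f =O[l] fun _ => (1 : ℂ) := by
  simpa using h 0

lemma sub (hf : HasAsympSeries l u f p) (hg : HasAsympSeries l u g q) :
    HasAsympSeries l u (fun x => f x - g x) (p - q) := fun N => by
  refine ((hf N).sub (hg N)).congr_left fun x => ?_
  simp only [map_sub, sub_mul, Finset.sum_sub_distrib]
  ring

lemma of_polynomial (hu : u =O[l] fun _ => (1 : ℂ)) (r : Polynomial ℂ) :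
    HasAsympSeries l u (fun x => r.eval (u x)) (r : PowerSeries ℂ) := fun N => by
  have h : Polynomial.X ^ N ∣ r - (r : PowerSeries ℂ).trunc N := by
    rw [Polynomial.X_pow_dvd_iff]
    intro d hd
    simp [PowerSeries.coeff_trunc, hd]
  refine (isBigO_eval_of_X_pow_dvd hu h).congr_left fun x => ?_
  rw [Polynomial.eval_sub, eval_trunc]

/-- Modulo X^N the product of the truncations is the truncation of the product, and a polynomial
divisible by X^N is O(u^N) because u is bounded. -/
lemma mul (hu : u =O[l] fun _ => (1 : ℂ)) (hf : HasAsympSeries l u f p)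
    (hg : HasAsympSeries l u g q) : HasAsympSeries l u (fun x => f x * g x) (p * q) := fun N => by
  have h : Polynomial.X ^ N ∣ p.trunc N * q.trunc N - (p * q).trunc N := by
    rw [Polynomial.X_pow_dvd_iff]
    intro d hd
    have := PowerSeries.coeff_mul_eq_coeff_trunc_mul_trunc p q hd
    rw [← Polynomial.coe_mul, Polynomial.coeff_coe] at this
    rw [Polynomial.coeff_sub, PowerSeries.coeff_trunc, if_pos hd, this, sub_self]
  have hp1 : (fun x => (p.trunc N).eval (u x)) =O[l] fun _ => (1 : ℂ) := by
    simpa using isBigO_eval_of_X_pow_dvd hu (N := 0) (r := p.trunc N) (by simp)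
  have h1 := (hf N).mul hg.isBigO_one
  have h2 := hp1.mul (hg N)
  have h3 := isBigO_eval_of_X_pow_dvd hu h
  simp only [mul_one, one_mul] at h1 h2
  refine ((h1.add h2).add h3).congr_left fun x => ?_
  simp only [← eval_trunc, Polynomial.eval_sub, Polynomial.eval_mul]
  ring

lemma const_mul (hu : u =O[l] fun _ => (1 : ℂ)) (c : ℂ) (hf : HasAsympSeries l u f p) :
    HasAsympSeries l u (fun x => c * f x) (PowerSeries.C c * p) := by
  simpa using (of_polynomial hu (Polynomial.C c)).mul hu hf

lemma gauge_mul (hu : u =O[l] fun _ => (1 : ℂ)) (hf : HasAsympSeries l u f p) :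
    HasAsympSeries l u (fun x => u x * f x) (PowerSeries.X * p) := by
  simpa using (of_polynomial hu Polynomial.X).mul hu hf

end HasAsympSeries

/-! ### The expansion of He_n for all orders n. -/

/-- `z → ∞` within the sector `|arg z| ≤ 3π/4 - δ`. -/
def hermiteSector (δ : ℝ) : Filter ℂ :=
  Bornology.cobounded ℂ ⊓ 𝓟 {z : ℂ | |arg z| ≤ 3 * Real.pi / 4 - δ}

lemma tendsto_inv_sq_hermiteSector (δ : ℝ) :
    Tendsto (fun z : ℂ => z⁻¹ ^ 2) (hermiteSector δ) (𝓝 0) := by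
  have h : Tendsto (fun z : ℂ => z⁻¹ ^ 2) (Bornology.cobounded ℂ) (𝓝 0) := by
    simpa using (tendsto_inv₀_cobounded (α := ℂ)).pow 2
  exact h.mono_left inf_le_left

lemma isBigO_inv_sq_hermiteSector (δ : ℝ) :
    (fun z : ℂ => z⁻¹ ^ 2) =O[hermiteSector δ] fun _ => (1 : ℂ) :=
  (tendsto_inv_sq_hermiteSector δ).isBigO_one ℂ

lemma eventually_ne_zero_hermiteSector (δ : ℝ) : ∀ᶠ z in hermiteSector δ, z ≠ 0 :=
  (Bornology.eventually_ne_cobounded 0).filter_mono inf_le_left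

lemma hasAsympSeries_hermiteMellin {n : ℂ} (hn : n.re < 0) {δ : ℝ} (hδ : 0 < δ) :
    HasAsympSeries (hermiteSector δ) (fun z => z⁻¹ ^ 2) (fun z => z ^ (-n) * hermiteMellin n z)
      (hermiteSeries n) := by
  have hpi := Real.pi_gt_three
  set d := min δ 1 with hd
  have hd0 : 0 < d := lt_min hδ one_pos
  have hd1 : d ≤ 1 := min_le_right _ _
  have hdδ : d ≤ δ := min_le_left _ _
  intro N
  -- The rotations by ±(π/4 - d/2) with margin η = d/2 cover arg z ≤ 0 and arg z ≥ 0 respectively,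
  -- up to |arg z| = 3π/4 - d. Capping d at 1 keeps the angle admissible when δ is large.
  have hθ : |Real.pi / 4 - d / 2| < Real.pi / 4 := abs_lt.2 ⟨by linarith, by linarith⟩
  obtain ⟨M₁, h₁⟩ := exists_bound_hermiteMellin_sub_sum hn hθ (half_pos hd0) N
  obtain ⟨M₂, h₂⟩ := exists_bound_hermiteMellin_sub_sum hn (by rwa [abs_neg] :
    |-(Real.pi / 4 - d / 2)| < Real.pi / 4) (half_pos hd0) N
  have hsec : ∀ᶠ z in hermiteSector δ, |arg z| ≤ 3 * Real.pi / 4 - δ :=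
    eventually_inf_principal.2 (Eventually.of_forall fun z hz => hz)
  refine IsBigO.of_bound (max M₁ M₂) ?_
  filter_upwards [hsec, eventually_ne_zero_hermiteSector δ] with z hz hz0
  have hz' := abs_le.1 hz
  rw [norm_pow]
  rcases le_total (arg z) 0 with h | h
  · refine (h₁ z hz0 (abs_le.2 ⟨by linarith, by linarith⟩)).trans ?_
    gcongr
    exact le_max_left _ _
  · refine (h₂ z hz0 (abs_le.2 ⟨by linarith, by linarith⟩)).trans ?_
    gcongr
    exact le_max_right _ _

lemma hermiteSeries_add_one (n : ℂ) : hermiteSeries (n + 1) =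
    hermiteSeries n - PowerSeries.C n * (PowerSeries.X * hermiteSeries (n - 1)) := by
  ext k
  rcases k with _ | k
  · simp [hermiteSeries]
  · have e0 : (ascPochhammer ℂ (2 * k + 1)).eval (-n) =
        -n * (ascPochhammer ℂ (2 * k)).eval (-n + 1) := by
      rw [ascPochhammer_succ_left]
      simp
    have e1 : (ascPochhammer ℂ (2 * k + 2)).eval (-n) =
        (ascPochhammer ℂ (2 * k + 1)).eval (-n) * (-n + (2 * k + 1)) := by
      rw [ascPochhammer_succ_eval]
      push_cast
      ring
    have e2 : (ascPochhammer ℂ (2 * k + 2)).eval (-n - 1) =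
        (-n - 1) * (ascPochhammer ℂ (2 * k + 1)).eval (-n) := by
      rw [ascPochhammer_succ_left]
      simp
    have h4 : (k ! : ℂ) ≠ 0 := by exact_mod_cast k.factorial_ne_zero
    have h5 : (k : ℂ) + 1 ≠ 0 := by exact_mod_cast k.succ_ne_zero
    simp only [hermiteSeries, map_sub, PowerSeries.coeff_C_mul, PowerSeries.coeff_succ_X_mul,
      PowerSeries.coeff_mk, Nat.factorial_succ]
    rw [show -(n + 1) = -n - 1 by ring, show -(n - 1) = -n + 1 by ring,
      show 2 * (k + 1) = 2 * k + 2 by ring, e1, e2, e0]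
    push_cast
    field_simp
    ring

/-- The asymptotic expansion of Hermite functions in the sector `|arg z| < 3π/4`. -/
theorem hasAsympSeries_hermiteHe (n : ℂ) {δ : ℝ} (hδ : 0 < δ) :
    HasAsympSeries (hermiteSector δ) (fun z => z⁻¹ ^ 2) (fun z => z ^ (-n) * hermiteHe n z)
      (hermiteSeries n) := by
  -- Induction on half-planes: the recurrence expresses order n through n - 1 and n - 2, and
  -- `hermiteSeries_add_one` is its formal counterpart.
  suffices H : ∀ k : ℕ, ∀ n : ℂ, n.re < -1 + k → HasAsympSeries (hermiteSector δ)
      (fun z => z⁻¹ ^ 2) (fun z => z ^ (-n) * hermiteHe n z) (hermiteSeries n) by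
    obtain ⟨k, hk⟩ := exists_nat_gt (n.re + 1)
    exact H k n (by linarith)
  intro k
  induction k with
  | zero =>
    intro n hn
    rw [Nat.cast_zero, add_zero] at hn
    refine (hasAsympSeries_hermiteMellin (by linarith) hδ).congr' (Eventually.of_forall fun z => ?_)
    simp only [hermiteHe_eq_hermiteMellin z hn]
  | succ k ih =>
    intro n hn
    rw [Nat.cast_succ] at hn
    have hu := isBigO_inv_sq_hermiteSector δ
    have h1 := ih (n - 1) (by rw [sub_re, one_re]; linarith)
    have h2 := ih (n - 1 - 1) (by rw [sub_re, sub_re, one_re]; linarith)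
    have e := hermiteSeries_add_one (n - 1)
    rw [sub_add_cancel] at e
    rw [e]
    refine (h1.sub ((h2.gauge_mul hu).const_mul hu (n - 1))).congr' ?_
    filter_upwards [eventually_ne_zero_hermiteSector δ] with z hz
    have hrec := hermiteHe_add_one (n - 1) z
    rw [sub_add_cancel] at hrec
    have e1 : z ^ (-(n - 1)) = z ^ (-n) * z := by
      rw [show -(n - 1) = -n + 1 by ring, cpow_add _ _ hz, cpow_one]
    have e2 : z ^ (-(n - 1 - 1)) = z ^ (-n) * z * z := by
      rw [show -(n - 1 - 1) = -n + 1 + 1 by ring, cpow_add _ _ hz, cpow_add _ _ hz, cpow_one]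
    rw [hrec, e1, e2]
    field_simp

/-! ### Hypergeometric coefficients as binomial sums. -/

/-- The generalized binomial coefficient `x(x-1)⋯(x-j+1)/j!`. -/
def genBinom (x : ℂ) : ℕ → ℂ
  | 0 => 1
  | j + 1 => genBinom x j * (x - j) / (j + 1)

lemma succ_mul_genBinom (x : ℂ) (j : ℕ) :
    ((j : ℂ) + 1) * genBinom x (j + 1) = (x - j) * genBinom x j := by
  have : (j : ℂ) + 1 ≠ 0 := by exact_mod_cast j.succ_ne_zero
  rw [genBinom]
  field_simp

lemma genBinom_add_one_succ (x : ℂ) (j : ℕ) :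
    genBinom (x + 1) (j + 1) = genBinom x (j + 1) + genBinom x j := by
  induction j with
  | zero => simp [genBinom]
  | succ j ih =>
    have h1 : ((j + 1 : ℕ) : ℂ) + 1 ≠ 0 := by exact_mod_cast (j + 1).succ_ne_zero
    refine mul_left_cancel₀ h1 ?_
    have e1 := succ_mul_genBinom (x + 1) (j + 1)
    have e2 := succ_mul_genBinom x (j + 1)
    have e3 := succ_mul_genBinom x j
    push_cast at *
    linear_combination e1 - e2 + (x - j) * ih - e3

lemma mul_genBinom_sub_one (x : ℂ) (j : ℕ) :
    x * genBinom (x - 1) j = (x - j) * genBinom x j := by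
  induction j with
  | zero => simp [genBinom]
  | succ j ih =>
    have h1 : (j : ℂ) + 1 ≠ 0 := by exact_mod_cast j.succ_ne_zero
    refine mul_left_cancel₀ h1 ?_
    have e1 := succ_mul_genBinom (x - 1) j
    have e2 := succ_mul_genBinom x j
    push_cast at *
    linear_combination x * e1 - (x - j - 1) * e2 + (x - 1 - j) * ih

lemma ascPochhammer_eval_neg_eq_genBinom (x : ℂ) (j : ℕ) :
    (ascPochhammer ℂ j).eval (-x) = (-1) ^ j * (j ! : ℂ) * genBinom x j := by
  induction j with
  | zero => simp [genBinom]
  | succ j ih =>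
    have h := succ_mul_genBinom x j
    rw [ascPochhammer_succ_eval, ih, Nat.factorial_succ, pow_succ]
    push_cast
    linear_combination (-1) ^ j * (j ! : ℂ) * h

lemma genBinom_natCast (k j : ℕ) : genBinom k j = k.choose j := by
  induction j with
  | zero => simp [genBinom]
  | succ j ih =>
    have h1 : (j : ℂ) + 1 ≠ 0 := by exact_mod_cast j.succ_ne_zero
    refine mul_left_cancel₀ h1 ?_
    rw [succ_mul_genBinom, ih]
    rcases le_or_gt j k with h | h
    · have := Nat.choose_succ_right_eq k j
      have h2 : ((k.choose (j + 1) : ℕ) : ℂ) * (j + 1) = k.choose j * (k - j) := by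
        rw [← Nat.cast_sub h]
        exact_mod_cast this
      linear_combination -h2
    · rw [Nat.choose_eq_zero_of_lt h, Nat.choose_eq_zero_of_lt (by omega)]
      simp

lemma ordinaryHypergeometric_neg_natCast (k : ℕ) (b c x : ℂ) :
    ordinaryHypergeometric (-(k : ℂ)) b c x = ∑ j ∈ Finset.range (k + 1),
      (-1) ^ j * (k.choose j : ℂ) * (ascPochhammer ℂ j).eval b *
        ((ascPochhammer ℂ j).eval c)⁻¹ * x ^ j := by
  rw [ordinaryHypergeometric_eq_tsum]
  have hterm : ∀ j : ℕ, ((j ! : ℂ)⁻¹ * (ascPochhammer ℂ j).eval (-(k : ℂ)) *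
      (ascPochhammer ℂ j).eval b * ((ascPochhammer ℂ j).eval c)⁻¹) • x ^ j =
      (-1) ^ j * (k.choose j : ℂ) * (ascPochhammer ℂ j).eval b *
        ((ascPochhammer ℂ j).eval c)⁻¹ * x ^ j := by
    intro j
    have h4 : (j ! : ℂ) ≠ 0 := by exact_mod_cast j.factorial_ne_zero
    rw [ascPochhammer_eval_neg_eq_genBinom, genBinom_natCast, smul_eq_mul]
    field_simp
  simp only [hterm]
  refine tsum_eq_sum fun j hj => ?_
  rw [Nat.choose_eq_zero_of_lt (by simpa using hj)]
  simp

lemma ascPochhammer_eval_two (j : ℕ) : (ascPochhammer ℂ j).eval 2 = ((j + 1)! : ℂ) := by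
  induction j with
  | zero => simp
  | succ j ih =>
    rw [ascPochhammer_succ_eval, ih, Nat.factorial_succ (j + 1)]
    push_cast
    ring

lemma gCoeff_eq_sum (n : ℂ) (k : ℕ) : gCoeff n k =
    ∑ j ∈ Finset.range (k + 1), (k.choose j : ℂ) * 2 ^ j * genBinom (n - 1) j := by
  rw [gCoeff, ordinaryHypergeometric_neg_natCast]
  refine Finset.sum_congr rfl fun j _ => ?_
  have h4 : (j ! : ℂ) ≠ 0 := by exact_mod_cast j.factorial_ne_zero
  have h5 : ((-1 : ℂ) ^ j) * (-1) ^ j = 1 := by rw [← mul_pow]; simp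
  rw [ascPochhammer_eval_one, show 1 - n = -(n - 1) by ring, ascPochhammer_eval_neg_eq_genBinom]
  field_simp
  linear_combination (k.choose j : ℂ) * genBinom (n - 1) j * h5

/-- The factor n is absorbed by n C(n-1, j) = (j+1) C(n, j+1), the j + 1 cancelling against (2)_j =
(j+1)!. -/
lemma mul_eCoeff_eq_sum (n : ℂ) (k : ℕ) : n * eCoeff n k =
    ∑ j ∈ Finset.range (k + 1), (k.choose j : ℂ) * 2 ^ j * genBinom n (j + 1) := by
  rw [eCoeff, ordinaryHypergeometric_neg_natCast, Finset.mul_sum]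
  refine Finset.sum_congr rfl fun j _ => ?_
  have h1 : (j : ℂ) + 1 ≠ 0 := by exact_mod_cast j.succ_ne_zero
  have h4 : (j ! : ℂ) ≠ 0 := by exact_mod_cast j.factorial_ne_zero
  have h5 : ((-1 : ℂ) ^ j) * (-1) ^ j = 1 := by rw [← mul_pow]; simp
  have h6 : n * genBinom (n - 1) j = (j + 1) * genBinom n (j + 1) := by
    rw [mul_genBinom_sub_one, succ_mul_genBinom]
  rw [ascPochhammer_eval_two, show 1 - n = -(n - 1) by ring, ascPochhammer_eval_neg_eq_genBinom,
    Nat.factorial_succ]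
  push_cast
  field_simp
  linear_combination (k.choose j : ℂ) * (n * genBinom (n - 1) j * h5 + h6)

/-- Pascal's rule in k and in n. This is the numerical counterpart of `hermiteSeries_product_add`,
as `eCoeff_difference` is of `hermiteSeries_product_sub`. -/
lemma gCoeff_succ (n : ℂ) (k : ℕ) :
    gCoeff (n + 1) (k + 1) = (n + 1) * eCoeff (n + 1) k + n * eCoeff n k := by
  rw [gCoeff_eq_sum, mul_eCoeff_eq_sum, mul_eCoeff_eq_sum, add_sub_cancel_right,
    Finset.sum_range_succ', ← Finset.sum_add_distrib]
  have h : ∑ j ∈ Finset.range (k + 1), ((k.choose (j + 1) : ℕ) : ℂ) * 2 ^ (j + 1) *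
      genBinom n (j + 1) + ((k + 1).choose 0 : ℕ) * 2 ^ 0 * genBinom n 0 =
      ∑ j ∈ Finset.range (k + 1), (k.choose j : ℂ) * 2 ^ j * genBinom n j := by
    have := Finset.sum_range_succ' (fun j => (k.choose j : ℂ) * 2 ^ j * genBinom n j) (k + 1)
    rw [Finset.sum_range_succ, Nat.choose_succ_self] at this
    simp only [Nat.choose_zero_right] at this ⊢
    rw [← this]
    simp
  simp only [Nat.choose_succ_succ, Nat.cast_add, add_mul, Finset.sum_add_distrib]
  rw [add_assoc, h, ← Finset.sum_add_distrib, ← Finset.sum_add_distrib]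
  refine Finset.sum_congr rfl fun j _ => ?_
  rw [genBinom_add_one_succ]
  ring

lemma eCoeff_difference (n : ℂ) (k : ℕ) :
    (2 * k + 1) * ((n + 1) * eCoeff (n + 1) k - n * eCoeff n k) =
      (n + 1) * gCoeff (n + 2) k - n * gCoeff n k := by
  rw [gCoeff_eq_sum, gCoeff_eq_sum, mul_eCoeff_eq_sum, mul_eCoeff_eq_sum,
    ← Finset.sum_sub_distrib, show n + 2 - 1 = n + 1 by ring]
  -- At j = 0 the truncated `j - 1` is harmless because of the factor j.
  have key : ∀ j : ℕ, (n + 1) * genBinom (n + 1) j - n * genBinom (n - 1) j =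
      (1 + 2 * j) * genBinom n j + j * genBinom n (j - 1) := by
    rintro (_ | i)
    · simp [genBinom]
    · rw [mul_genBinom_sub_one, genBinom_add_one_succ, Nat.add_sub_cancel]
      have := succ_mul_genBinom n i
      push_cast
      linear_combination -this
  have hR : (n + 1) * (∑ j ∈ Finset.range (k + 1), (k.choose j : ℂ) * 2 ^ j * genBinom (n + 1) j) -
      n * (∑ j ∈ Finset.range (k + 1), (k.choose j : ℂ) * 2 ^ j * genBinom (n - 1) j) =
      ∑ j ∈ Finset.range (k + 1), (k.choose j : ℂ) * 2 ^ j * ((1 + 2 * j) * genBinom n j) +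
      ∑ j ∈ Finset.range (k + 1), (k.choose j : ℂ) * 2 ^ j * (j * genBinom n (j - 1)) := by
    rw [Finset.mul_sum, Finset.mul_sum, ← Finset.sum_sub_distrib, ← Finset.sum_add_distrib]
    refine Finset.sum_congr rfl fun j _ => ?_
    linear_combination (k.choose j : ℂ) * 2 ^ j * key j
  -- Shift of j by one, with (j+1) C(k, j+1) = (k-j) C(k, j); the unmatched terms at both ends are
  -- zero.
  have hS : ∑ j ∈ Finset.range (k + 1), (k.choose j : ℂ) * 2 ^ j * (j * genBinom n (j - 1)) =
      ∑ j ∈ Finset.range (k + 1), (k.choose j : ℂ) * 2 ^ j * (2 * (k - j) * genBinom n j) := by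
    rw [Finset.sum_range_succ', Finset.sum_range_succ]
    simp only [Nat.cast_zero, zero_mul, mul_zero, sub_self, Nat.add_sub_cancel]
    congr 1
    refine Finset.sum_congr rfl fun j hj => ?_
    have hjk : j ≤ k := (Finset.mem_range.1 hj).le
    have h2 : ((k.choose (j + 1) : ℕ) : ℂ) * (j + 1) = k.choose j * (k - j) := by
      rw [← Nat.cast_sub hjk]
      exact_mod_cast Nat.choose_succ_right_eq k j
    push_cast
    linear_combination 2 ^ (j + 1) * genBinom n j * h2
  rw [hR, hS, ← Finset.sum_add_distrib, Finset.mul_sum]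
  refine Finset.sum_congr rfl fun j _ => ?_
  rw [genBinom_add_one_succ]
  ring

/-! ### Polynomial dependence on n and identities between formal series. -/

/-- `f` is given by a polynomial. -/
def IsPolynomialFun (f : ℂ → ℂ) : Prop := ∃ p : Polynomial ℂ, ∀ x, f x = p.eval x

namespace IsPolynomialFun

variable {f g : ℂ → ℂ}

lemma mul (hf : IsPolynomialFun f) (hg : IsPolynomialFun g) :
    IsPolynomialFun fun x => f x * g x := by
  obtain ⟨p, hp⟩ := hf
  obtain ⟨q, hq⟩ := hg
  exact ⟨p * q, fun x => by simp only [hp, hq, Polynomial.eval_mul]⟩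

lemma sub (hf : IsPolynomialFun f) (hg : IsPolynomialFun g) :
    IsPolynomialFun fun x => f x - g x := by
  obtain ⟨p, hp⟩ := hf
  obtain ⟨q, hq⟩ := hg
  exact ⟨p - q, fun x => by simp only [hp, hq, Polynomial.eval_sub]⟩

lemma const (c : ℂ) : IsPolynomialFun fun _ => c := ⟨Polynomial.C c, fun x => by simp⟩

lemma id : IsPolynomialFun fun x => x := ⟨Polynomial.X, fun x => by simp⟩

lemma sum {ι : Type*} {s : Finset ι} {f : ι → ℂ → ℂ} (h : ∀ i ∈ s, IsPolynomialFun (f i)) :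
    IsPolynomialFun fun x => ∑ i ∈ s, f i x := by
  choose! p hp using h
  exact ⟨∑ i ∈ s, p i, fun x => by
    rw [Polynomial.eval_finsetSum]
    exact Finset.sum_congr rfl fun i hi => hp i hi x⟩

lemma eval_comp (p : Polynomial ℂ) (hf : IsPolynomialFun f) :
    IsPolynomialFun fun x => p.eval (f x) := by
  obtain ⟨q, hq⟩ := hf
  exact ⟨p.comp q, fun x => by simp only [Polynomial.eval_comp, hq]⟩

lemma comp (hf : IsPolynomialFun f) (hg : IsPolynomialFun g) :
    IsPolynomialFun fun x => f (g x) := by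
  obtain ⟨p, hp⟩ := hf
  simp only [hp]
  exact eval_comp p hg

/-- A polynomial function is determined by its value at `0` and its forward differences. -/
lemma eq_of_forward_difference (hf : IsPolynomialFun f) (hg : IsPolynomialFun g) (h0 : f 0 = g 0)
    (h : ∀ x, f (x + 1) - f x = g (x + 1) - g x) (x : ℂ) : f x = g x := by
  have hnat : ∀ k : ℕ, f k = g k := by
    intro k
    induction k with
    | zero => simpa using h0
    | succ k ih =>
      rw [Nat.cast_succ]
      linear_combination h k + ih
  obtain ⟨p, hp⟩ := hf
  obtain ⟨q, hq⟩ := hg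
  have : p = q := by
    refine Polynomial.eq_of_infinite_eval_eq p q
      ((Set.infinite_range_of_injective (Nat.cast_injective (R := ℂ))).mono ?_)
    rintro _ ⟨k, rfl⟩
    show p.eval (k : ℂ) = q.eval (k : ℂ)
    rw [← hp, ← hq, hnat]
  rw [hp, hq, this]

end IsPolynomialFun

/-- A family of power series whose coefficients are polynomials in the parameter. -/
def HasPolynomialCoeffs (F : ℂ → PowerSeries ℂ) : Prop :=
  ∀ k, IsPolynomialFun fun n => PowerSeries.coeff k (F n)

lemma HasPolynomialCoeffs.mul {F G : ℂ → PowerSeries ℂ} (hF : HasPolynomialCoeffs F)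
    (hG : HasPolynomialCoeffs G) : HasPolynomialCoeffs fun n => F n * G n := fun k => by
  simp only [PowerSeries.coeff_mul]
  exact IsPolynomialFun.sum fun i _ => (hF i.1).mul (hG i.2)

lemma HasPolynomialCoeffs.comp {F : ℂ → PowerSeries ℂ} (hF : HasPolynomialCoeffs F)
    {g : ℂ → ℂ} (hg : IsPolynomialFun g) : HasPolynomialCoeffs fun n => F (g n) :=
  fun k => (hF k).comp hg

lemma hasPolynomialCoeffs_hermiteSeries : HasPolynomialCoeffs hermiteSeries := fun k => by
  simp only [hermiteSeries, PowerSeries.coeff_mk, div_eq_mul_inv]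
  refine ((IsPolynomialFun.const _).mul (IsPolynomialFun.eval_comp _ ?_)).mul
    (IsPolynomialFun.const _)
  simpa using (IsPolynomialFun.const 0).sub IsPolynomialFun.id

/-- The asymptotic expansion of `(iz)^n He_{-n}(iz)` in powers of `z⁻²`. -/
def dualHermiteSeries (n : ℂ) : PowerSeries ℂ := PowerSeries.rescale (-1) (hermiteSeries (-n))

lemma hasPolynomialCoeffs_dualHermiteSeries : HasPolynomialCoeffs dualHermiteSeries := fun k => by
  simp only [dualHermiteSeries, PowerSeries.coeff_rescale]
  refine (IsPolynomialFun.const _).mul ((hasPolynomialCoeffs_hermiteSeries k).comp ?_)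
  simpa using (IsPolynomialFun.const 0).sub IsPolynomialFun.id

lemma dualHermiteSeries_eq (n : ℂ) : dualHermiteSeries n = dualHermiteSeries (n + 1) -
    PowerSeries.C (n + 1) * (PowerSeries.X * dualHermiteSeries (n + 2)) := by
  have h := congrArg (PowerSeries.rescale (-1 : ℂ)) (hermiteSeries_add_one (-(n + 1)))
  rw [show -(n + 1) + 1 = -n by ring, show -(n + 1) - 1 = -(n + 2) by ring] at h
  have hC : PowerSeries.rescale (-1 : ℂ) (PowerSeries.C (-(n + 1))) = PowerSeries.C (-(n + 1)) := by
    ext k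
    rw [PowerSeries.coeff_rescale, PowerSeries.coeff_C]
    split_ifs with hk <;> simp [hk]
  rw [map_sub, map_mul, map_mul, PowerSeries.rescale_neg_one_X, hC] at h
  simp only [dualHermiteSeries]
  rw [h, map_neg]
  ring

lemma hermiteSeries_zero : hermiteSeries 0 = 1 := by
  ext k
  rcases k with _ | k
  · simp [hermiteSeries]
  · simp [hermiteSeries, PowerSeries.coeff_one, mul_add, ascPochhammer_succ_left]

lemma dualHermiteSeries_zero : dualHermiteSeries 0 = 1 := by
  rw [dualHermiteSeries, neg_zero, hermiteSeries_zero, map_one]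

lemma constantCoeff_hermiteSeries (n : ℂ) : PowerSeries.constantCoeff (hermiteSeries n) = 1 := by
  rw [← PowerSeries.coeff_zero_eq_constantCoeff_apply]
  simp [hermiteSeries]

lemma constantCoeff_dualHermiteSeries (n : ℂ) :
    PowerSeries.constantCoeff (dualHermiteSeries n) = 1 := by
  rw [← PowerSeries.coeff_zero_eq_constantCoeff_apply, dualHermiteSeries, PowerSeries.coeff_rescale]
  simp [constantCoeff_hermiteSeries]

/-- The Wronskian-type identity for the formal Hermite series. -/
lemma hermiteSeries_wronskian (n : ℂ) : hermiteSeries n * dualHermiteSeries n -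
    PowerSeries.C n * (PowerSeries.X * (hermiteSeries (n - 1) * dualHermiteSeries (n + 1))) = 1 := by
  have hid : IsPolynomialFun fun n => n := IsPolynomialFun.id
  have hm1 : IsPolynomialFun fun n : ℂ => n - 1 := hid.sub (IsPolynomialFun.const 1)
  have hp1 : IsPolynomialFun fun n : ℂ => n + 1 := by
    simpa using hid.sub (IsPolynomialFun.const (-1))
  set W : ℂ → PowerSeries ℂ := fun n => hermiteSeries n * dualHermiteSeries n -
    PowerSeries.C n * (PowerSeries.X * (hermiteSeries (n - 1) * dualHermiteSeries (n + 1)))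
    with hW
  have hA := hasPolynomialCoeffs_hermiteSeries.mul hasPolynomialCoeffs_dualHermiteSeries
  have hC := (hasPolynomialCoeffs_hermiteSeries.comp hm1).mul
    (hasPolynomialCoeffs_dualHermiteSeries.comp hp1)
  have hWpoly : HasPolynomialCoeffs W := by
    intro k
    simp only [hW, map_sub, PowerSeries.coeff_C_mul]
    refine (hA k).sub (hid.mul ?_)
    rcases k with _ | k
    · simpa using IsPolynomialFun.const 0
    · simp only [PowerSeries.coeff_succ_X_mul]
      exact hC k
  -- The two recurrences make W periodic in n with period 1; polynomial coefficients then make it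
  -- constant, equal to its value at n = 0.
  have hstep : ∀ n, W (n + 1) = W n := by
    intro n
    have e1 := hermiteSeries_add_one n
    have e2 := dualHermiteSeries_eq n
    simp only [hW, add_sub_cancel_right]
    rw [show n + 1 + 1 = n + 2 by ring]
    linear_combination dualHermiteSeries (n + 1) * e1 - hermiteSeries n * e2
  have h0 : W 0 = 1 := by
    simp [hW, hermiteSeries_zero, dualHermiteSeries_zero]
  show W n = 1
  ext k
  refine (hWpoly k).eq_of_forward_difference (IsPolynomialFun.const _) ?_ (fun x => ?_) n
  · rw [h0]
  · rw [hstep, sub_self, sub_self]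

lemma hermiteSeries_product_add (n : ℂ) :
    hermiteSeries n * dualHermiteSeries (n + 1) =
      hermiteSeries (n + 1) * dualHermiteSeries (n + 1) +
        hermiteSeries n * dualHermiteSeries n - 1 := by
  have e1 := hermiteSeries_add_one n
  have e2 := hermiteSeries_wronskian n
  linear_combination (-dualHermiteSeries (n + 1)) * e1 - e2

lemma hermiteSeries_product_sub (n : ℂ) :
    hermiteSeries (n + 1) * dualHermiteSeries (n + 1) - hermiteSeries n * dualHermiteSeries n =
      PowerSeries.X * (PowerSeries.C (n + 1) * (hermiteSeries (n + 1) * dualHermiteSeries (n + 2))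
        - PowerSeries.C n * (hermiteSeries (n - 1) * dualHermiteSeries n)) := by
  have e1 := hermiteSeries_add_one n
  have e2 := dualHermiteSeries_eq n
  linear_combination dualHermiteSeries n * e1 - hermiteSeries (n + 1) * e2

/-- For k = 0 the truncated `2 * k - 1` is 0, and 0‼ = 1 plays the role of (-1)‼. -/
lemma doubleFactorial_two_mul_add_one (k : ℕ) : (2 * k + 1)‼ = (2 * k + 1) * (2 * k - 1)‼ := by
  rcases k with _ | k
  · rfl
  · rw [show 2 * (k + 1) + 1 = (2 * k + 1) + 2 by ring, Nat.doubleFactorial_add_two]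
    rfl

lemma isPolynomialFun_genBinom (j : ℕ) : IsPolynomialFun fun x => genBinom x j := by
  induction j with
  | zero => exact IsPolynomialFun.const 1
  | succ j ih =>
    simp only [genBinom, div_eq_mul_inv]
    exact (ih.mul (IsPolynomialFun.id.sub (IsPolynomialFun.const _))).mul (IsPolynomialFun.const _)

lemma isPolynomialFun_mul_eCoeff (k : ℕ) : IsPolynomialFun fun n => n * eCoeff n k := by
  simp only [mul_eCoeff_eq_sum]
  exact IsPolynomialFun.sum fun j _ => (IsPolynomialFun.const _).mul (isPolynomialFun_genBinom _)

/-- A ladder in k. Degree k of S_{n-1} D_n gives the forward difference in n of degree k + 1 of S_n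
D_n, hence that coefficient itself, as it is a polynomial vanishing at n = 0. Then
`hermiteSeries_product_add` returns degree k + 1 of S_{n-1} D_n. -/
lemma coeff_hermiteSeries_products (k : ℕ) :
    (∀ n, PowerSeries.coeff k (hermiteSeries (n - 1) * dualHermiteSeries n) =
      ((2 * k - 1)‼ : ℕ) * gCoeff n k) ∧
    ∀ n, PowerSeries.coeff (k + 1) (hermiteSeries n * dualHermiteSeries n) =
      ((2 * k + 1)‼ : ℕ) * (n * eCoeff n k) := by
  have step : ∀ k : ℕ, (∀ n, PowerSeries.coeff k (hermiteSeries (n - 1) * dualHermiteSeries n) =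
      ((2 * k - 1)‼ : ℕ) * gCoeff n k) →
      ∀ n, PowerSeries.coeff (k + 1) (hermiteSeries n * dualHermiteSeries n) =
        ((2 * k + 1)‼ : ℕ) * (n * eCoeff n k) := by
    intro k hk n
    refine IsPolynomialFun.eq_of_forward_difference
      ((hasPolynomialCoeffs_hermiteSeries.mul hasPolynomialCoeffs_dualHermiteSeries) (k + 1))
      ((IsPolynomialFun.const _).mul (isPolynomialFun_mul_eCoeff k)) ?_ (fun x => ?_) n
    · simp [hermiteSeries_zero, dualHermiteSeries_zero, PowerSeries.coeff_one]
    · have h := congrArg (PowerSeries.coeff (k + 1)) (hermiteSeries_product_sub x)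
      have h2 := hk (x + 2)
      rw [show x + 2 - 1 = x + 1 by ring] at h2
      rw [map_sub, PowerSeries.coeff_succ_X_mul, map_sub, PowerSeries.coeff_C_mul,
        PowerSeries.coeff_C_mul, hk, h2] at h
      rw [h, doubleFactorial_two_mul_add_one]
      push_cast
      linear_combination (-((2 * k - 1)‼ : ℂ)) * eCoeff_difference x k
  induction k with
  | zero =>
    have h0 : ∀ n, PowerSeries.coeff 0 (hermiteSeries (n - 1) * dualHermiteSeries n) =
      ((2 * 0 - 1)‼ : ℕ) * gCoeff n 0 := by
      intro n
      simp [constantCoeff_hermiteSeries, constantCoeff_dualHermiteSeries, gCoeff_eq_sum, genBinom]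
    exact ⟨h0, step 0 h0⟩
  | succ k ih =>
    have h1 : ∀ n, PowerSeries.coeff (k + 1) (hermiteSeries (n - 1) * dualHermiteSeries n) =
      ((2 * (k + 1) - 1)‼ : ℕ) * gCoeff n (k + 1) := by
      intro n
      have h := congrArg (PowerSeries.coeff (k + 1)) (hermiteSeries_product_add (n - 1))
      rw [map_sub, map_add, ih.2, ih.2, sub_add_cancel, PowerSeries.coeff_one,
        if_neg k.succ_ne_zero] at h
      have hg := gCoeff_succ (n - 1) k
      rw [sub_add_cancel] at hg
      rw [h, hg, show 2 * (k + 1) - 1 = 2 * k + 1 by omega]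
      ring
    exact ⟨h1, step (k + 1) h1⟩

/-! ### Substitution λ/√ε and comparison with the resolvent. -/

namespace HasAsympSeries

variable {α : Type*} {l : Filter α} {u f : α → ℂ} {p : PowerSeries ℂ}

lemma rescale {c : ℂ} (h : HasAsympSeries l (fun x => c * u x) f p) :
    HasAsympSeries l u f (PowerSeries.rescale c p) := fun N => by
  have h1 : (fun x => (c * u x) ^ N) =O[l] fun x => u x ^ N := by
    simp only [mul_pow]
    exact (isBigO_refl _ _).const_mul_left _
  refine ((h N).trans h1).congr_left fun x => ?_
  congr 1
  refine Finset.sum_congr rfl fun m _ => ?_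
  rw [PowerSeries.coeff_rescale, mul_pow]
  ring

lemma expand_two (hu : u =O[l] fun _ => (1 : ℂ)) (h : HasAsympSeries l (fun x => u x ^ 2) f p) :
    HasAsympSeries l u f (PowerSeries.expand 2 two_ne_zero p) := fun N => by
  have h1 : (fun x => (u x ^ 2) ^ N) =O[l] fun x => u x ^ N := by
    have := (isBigO_refl (fun x => u x ^ N) l).mul (hu.pow N)
    simp only [one_pow, mul_one] at this
    refine this.congr_left fun x => ?_
    ring
  have h2 : Polynomial.X ^ N ∣ Polynomial.expand ℂ 2 (p.trunc N) -
      (PowerSeries.expand 2 two_ne_zero p).trunc N := by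
    rw [Polynomial.X_pow_dvd_iff]
    intro d hd
    have hd2 : d / 2 < N := by omega
    rw [Polynomial.coeff_sub, Polynomial.coeff_expand two_pos, PowerSeries.coeff_trunc,
      PowerSeries.coeff_trunc, if_pos hd2, if_pos hd, PowerSeries.coeff_expand, sub_self]
  refine (((h N).trans h1).add (isBigO_eval_of_X_pow_dvd hu h2)).congr_left fun x => ?_
  simp only [← eval_trunc, Polynomial.eval_sub, Polynomial.expand_eval]
  ring

end HasAsympSeries

lemma arg_I_add_arg_mem {z : ℂ} {δ : ℝ} (hδ : 0 < δ)
    (h₁ : -(3 * Real.pi / 4) + δ ≤ arg z) (h₂ : arg z ≤ Real.pi / 4 - δ) :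
    arg I + arg z ∈ Ioc (-Real.pi) Real.pi := by
  have := Real.pi_pos
  rw [arg_I]
  constructor <;> linarith

lemma eventually_atInftySector {s : ℂ} (hs : s ≠ 0) (δ : ℝ) : ∀ᶠ lam in atInftySector s δ,
    lam / s ≠ 0 ∧ -(3 * Real.pi / 4) + δ ≤ arg (lam / s) ∧ arg (lam / s) ≤ Real.pi / 4 - δ := by
  have h1 : ∀ᶠ lam in atInftySector s δ, lam ≠ 0 :=
    (Bornology.eventually_ne_cobounded 0).filter_mono inf_le_left
  have h2 : ∀ᶠ lam in atInftySector s δ,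
      -(3 * Real.pi / 4) + δ ≤ arg (lam / s) ∧ arg (lam / s) ≤ Real.pi / 4 - δ :=
    eventually_inf_principal.2 (Eventually.of_forall fun z hz => hz)
  filter_upwards [h1, h2] with lam h h'
  exact ⟨div_ne_zero h hs, h'⟩

lemma tendsto_const_mul_atInftySector (s : ℂ) {c : ℂ} (hc : c ≠ 0) (δ : ℝ) :
    Tendsto (fun lam => c * lam) (atInftySector s δ) (Bornology.cobounded ℂ) :=
  (tendsto_mul_left_cobounded hc).mono_left inf_le_left

lemma tendsto_div_hermiteSector {s : ℂ} (hs : s ≠ 0) (δ : ℝ) :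
    Tendsto (fun lam => lam / s) (atInftySector s δ) (hermiteSector δ) := by
  refine tendsto_inf.2 ⟨?_, tendsto_principal.2 ?_⟩
  · simpa [div_eq_inv_mul] using tendsto_const_mul_atInftySector s (inv_ne_zero hs) δ
  · filter_upwards [eventually_atInftySector hs δ] with lam h
    have := Real.pi_pos
    exact abs_le.2 ⟨by linarith, by linarith⟩

/-- Multiplication by i adds π/2 to the argument, so the upper limit π/4 - δ becomes 3π/4 - δ: this
fixes the upper edge of the sector, while z itself fixes the lower one. -/
lemma tendsto_I_mul_div_hermiteSector {s : ℂ} (hs : s ≠ 0) {δ : ℝ} (hδ : 0 < δ) :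
    Tendsto (fun lam => I * (lam / s)) (atInftySector s δ) (hermiteSector δ) := by
  refine tendsto_inf.2 ⟨?_, tendsto_principal.2 ?_⟩
  · refine (tendsto_const_mul_atInftySector s (c := I * s⁻¹)
      (mul_ne_zero I_ne_zero (inv_ne_zero hs)) δ).congr fun lam => ?_
    ring
  · filter_upwards [eventually_atInftySector hs δ] with lam h
    have := Real.pi_pos
    show |arg (I * (lam / s))| ≤ _
    rw [arg_mul I_ne_zero h.1 (arg_I_add_arg_mem hδ h.2.1 h.2.2), arg_I]
    exact abs_le.2 ⟨by linarith, by linarith⟩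

lemma I_mul_cpow_eventually {s : ℂ} (hs : s ≠ 0) {δ : ℝ} (hδ : 0 < δ) (n : ℂ) :
    ∀ᶠ lam in atInftySector s δ, (I * (lam / s)) ^ n = I ^ n * (lam / s) ^ n := by
  filter_upwards [eventually_atInftySector hs δ] with lam h
  exact mul_cpow_of_arg_add_arg_mem I_ne_zero h.1 (arg_I_add_arg_mem hδ h.2.1 h.2.2) n

lemma isBigO_inv_atInftySector (s : ℂ) (δ : ℝ) :
    (fun lam : ℂ => lam⁻¹) =O[atInftySector s δ] fun _ => (1 : ℂ) :=
  (tendsto_inv₀_cobounded.mono_left inf_le_left).isBigO_one ℂ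

/-- The product of Hermite functions that enters the entries of `M`, expanded in powers of
`λ⁻²`. -/
lemma hasAsympSeries_product {s : ℂ} (hs : s ≠ 0) {δ : ℝ} (hδ : 0 < δ) (m n : ℂ) :
    HasAsympSeries (atInftySector s δ) (fun lam => lam⁻¹)
      (fun lam => I ^ n * ((lam / s) ^ (n - m) *
        (hermiteHe m (lam / s) * hermiteHe (-n) (I * (lam / s)))))
      (PowerSeries.expand 2 two_ne_zero (PowerSeries.rescale (s ^ 2)
        (hermiteSeries m * dualHermiteSeries n))) := by
  have hu := isBigO_inv_atInftySector s δ
  have hz := (isBigO_inv_sq_hermiteSector δ).comp_tendsto (tendsto_div_hermiteSector hs δ)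
  have h1 := (hasAsympSeries_hermiteHe m hδ).comp_tendsto (tendsto_div_hermiteSector hs δ)
  have h2 := (hasAsympSeries_hermiteHe (-n) hδ).comp_tendsto (tendsto_I_mul_div_hermiteSector hs hδ)
  -- Since (iz)⁻² = -z⁻², rescaling by -1 turns the expansion at iz into `dualHermiteSeries`;
  -- rescaling by s² then passes from z⁻² to λ⁻².
  have e2 : ((fun z : ℂ => z⁻¹ ^ 2) ∘ fun lam => I * (lam / s)) =
      fun lam => -1 * ((fun z : ℂ => z⁻¹ ^ 2) ∘ fun lam => lam / s) lam := by
    ext lam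
    simp [mul_pow]
  rw [e2] at h2
  have h3 := h1.mul hz h2.rescale
  have e3 : ((fun z : ℂ => z⁻¹ ^ 2) ∘ fun lam => lam / s) =
      fun lam => s ^ 2 * (lam⁻¹) ^ 2 := by
    ext lam
    rw [Function.comp_apply, inv_div, div_eq_mul_inv, mul_pow]
  rw [e3] at h3
  refine (h3.rescale.expand_two hu).congr' ?_
  filter_upwards [eventually_atInftySector hs δ, I_mul_cpow_eventually hs hδ n] with lam h hI
  simp only [Function.comp_apply, neg_neg]
  rw [hI, sub_eq_add_neg, cpow_add _ _ h.1]
  ring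

lemma resolventCoeff_odd (n ε : ℂ) (k : ℕ) : resolventCoeff n ε (2 * k + 1) =
    (ε ^ k * ((2 * k - 1)‼ : ℕ) : ℂ) • !![0, -(ε * n * gCoeff (n + 1) k); gCoeff n k, 0] := by
  have h : 2 * k / 2 = k := by omega
  simp only [resolventCoeff, h, if_pos (even_two_mul k)]

lemma resolventCoeff_even (n ε : ℂ) (k : ℕ) : resolventCoeff n ε (2 * k + 1 + 1) =
    (ε * n * ε ^ k * ((2 * k - 1)‼ : ℕ) * (2 * k + 1) * eCoeff n k : ℂ) • !![1, 0; 0, -1] := by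
  have h : (2 * k + 1) / 2 = k := by omega
  have h' : ¬ Even (2 * k + 1) := by simp
  simp only [resolventCoeff, h, if_neg h']

lemma nat_cases_zero_odd_even (m : ℕ) : m = 0 ∨ ∃ k, m = 2 * k + 1 ∨ m = 2 * k + 1 + 1 := by
  rcases m with _ | m
  · exact Or.inl rfl
  · exact Or.inr ⟨m / 2, by omega⟩

lemma coeff_expand_two_odd (p : PowerSeries ℂ) (k : ℕ) :
    PowerSeries.coeff (2 * k + 1) (PowerSeries.expand 2 two_ne_zero p) = 0 :=
  PowerSeries.coeff_expand_of_not_dvd 2 two_ne_zero p (by omega)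

lemma coeff_expand_two_even (p : PowerSeries ℂ) (k : ℕ) :
    PowerSeries.coeff (2 * k) (PowerSeries.expand 2 two_ne_zero p) = PowerSeries.coeff k p :=
  PowerSeries.coeff_expand_mul 2 two_ne_zero p k

lemma constantCoeff_expand_rescale (c : ℂ) (p : PowerSeries ℂ) : PowerSeries.constantCoeff
    (PowerSeries.expand 2 two_ne_zero (PowerSeries.rescale c p)) = PowerSeries.constantCoeff p := by
  rw [PowerSeries.constantCoeff_expand, ← PowerSeries.coeff_zero_eq_constantCoeff_apply,
    PowerSeries.coeff_rescale]
  simp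

/-- The diagonal entries of the formal resolvent. -/
lemma mk_resolventCoeff_zero_zero (n ε : ℂ) :
    (PowerSeries.mk fun m => resolventCoeff n ε m 0 0) = PowerSeries.expand 2 two_ne_zero
      (PowerSeries.rescale ε (hermiteSeries n * dualHermiteSeries n)) := by
  ext m
  rw [PowerSeries.coeff_mk]
  rcases nat_cases_zero_odd_even m with rfl | ⟨k, rfl | rfl⟩
  · rw [PowerSeries.coeff_zero_eq_constantCoeff_apply, constantCoeff_expand_rescale, map_mul,
      constantCoeff_hermiteSeries, constantCoeff_dualHermiteSeries]
    simp [resolventCoeff]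
  · rw [resolventCoeff_odd, coeff_expand_two_odd]
    simp
  · rw [resolventCoeff_even, show 2 * k + 1 + 1 = 2 * (k + 1) by ring, coeff_expand_two_even,
      PowerSeries.coeff_rescale, (coeff_hermiteSeries_products k).2,
      doubleFactorial_two_mul_add_one]
    simp
    ring

lemma mk_resolventCoeff_zero_one (n ε : ℂ) :
    (PowerSeries.mk fun m => resolventCoeff n ε m 0 1) = PowerSeries.C (-(ε * n)) *
      (PowerSeries.X * PowerSeries.expand 2 two_ne_zero
        (PowerSeries.rescale ε (hermiteSeries n * dualHermiteSeries (n + 1)))) := by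
  ext m
  rw [PowerSeries.coeff_mk, PowerSeries.coeff_C_mul]
  rcases nat_cases_zero_odd_even m with rfl | ⟨k, rfl | rfl⟩
  · simp [resolventCoeff]
  · have h := (coeff_hermiteSeries_products k).1 (n + 1)
    rw [add_sub_cancel_right] at h
    rw [resolventCoeff_odd, PowerSeries.coeff_succ_X_mul, coeff_expand_two_even,
      PowerSeries.coeff_rescale, h]
    simp
    ring
  · rw [resolventCoeff_even, PowerSeries.coeff_succ_X_mul, coeff_expand_two_odd]
    simp

lemma mk_resolventCoeff_one_zero (n ε : ℂ) :
    (PowerSeries.mk fun m => resolventCoeff n ε m 1 0) =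
      PowerSeries.X * PowerSeries.expand 2 two_ne_zero
        (PowerSeries.rescale ε (hermiteSeries (n - 1) * dualHermiteSeries n)) := by
  ext m
  rw [PowerSeries.coeff_mk]
  rcases nat_cases_zero_odd_even m with rfl | ⟨k, rfl | rfl⟩
  · simp [resolventCoeff]
  · rw [resolventCoeff_odd, PowerSeries.coeff_succ_X_mul, coeff_expand_two_even,
      PowerSeries.coeff_rescale, (coeff_hermiteSeries_products k).1]
    simp
    ring
  · rw [resolventCoeff_even, PowerSeries.coeff_succ_X_mul, coeff_expand_two_odd]
    simp

/-- Beyond degree 0 the Wronskian identity makes this entry the negative of the other diagonal one.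
-/
lemma mk_resolventCoeff_one_one (n ε : ℂ) :
    (PowerSeries.mk fun m => resolventCoeff n ε m 1 1) = PowerSeries.C (-(ε * n)) *
      (PowerSeries.X * (PowerSeries.X * PowerSeries.expand 2 two_ne_zero
        (PowerSeries.rescale ε (hermiteSeries (n - 1) * dualHermiteSeries (n + 1))))) := by
  ext m
  rw [PowerSeries.coeff_mk, PowerSeries.coeff_C_mul]
  rcases nat_cases_zero_odd_even m with rfl | ⟨k, rfl | rfl⟩
  · simp [resolventCoeff]
  · rw [resolventCoeff_odd, PowerSeries.coeff_succ_X_mul]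
    rcases k with _ | k
    · simp
    · rw [show 2 * (k + 1) = (2 * k + 1) + 1 by ring, PowerSeries.coeff_succ_X_mul,
        coeff_expand_two_odd]
      simp
  · have h := congrArg (PowerSeries.coeff (k + 1)) (hermiteSeries_wronskian n)
    rw [map_sub, PowerSeries.coeff_C_mul, PowerSeries.coeff_succ_X_mul,
      (coeff_hermiteSeries_products k).2, PowerSeries.coeff_one, if_neg k.succ_ne_zero,
      doubleFactorial_two_mul_add_one] at h
    push_cast at h
    rw [resolventCoeff_even, PowerSeries.coeff_succ_X_mul, PowerSeries.coeff_succ_X_mul,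
      coeff_expand_two_even, PowerSeries.coeff_rescale]
    simp only [Matrix.smul_apply, Matrix.of_apply, Matrix.cons_val', Matrix.cons_val_one,
      Matrix.cons_val_fin_one, smul_eq_mul]
    linear_combination (-(ε * ε ^ k)) * h

theorem mainTheorem10 (n ε s : ℂ) (hε : ε ≠ 0) (hs : s ^ 2 = ε) (δ : ℝ) (hδ : 0 < δ) :
    HasAsymptoticExpansion (hermiteMatrix n s) (formalResolvent n ε) (atInftySector s δ) := by
  have hs0 : s ≠ 0 := by
    rintro rfl
    exact hε (by simpa using hs.symm)
  have hu := isBigO_inv_atInftySector s δ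
  have hev := eventually_atInftySector hs0 δ
  suffices H : ∀ a b : Fin 2, HasAsympSeries (atInftySector s δ) (fun lam => lam⁻¹)
      (fun lam => hermiteMatrix n s lam a b)
      (PowerSeries.mk fun m => resolventCoeff n ε m a b) by
    intro N a b
    -- The sum up to m = N has N + 1 terms, hence the shift of index.
    simpa only [formalResolvent, PowerSeries.coeff_mk] using H a b (N + 1)
  have hprod := hasAsympSeries_product hs0 hδ
  rw [hs] at hprod
  -- The second column involves He_{-(n+1)}; the extra factor i in i^(n+1) accounts for the -i in
  -- the definition of M.
  have hI : I ^ (n + 1) = I ^ n * I := by rw [cpow_add _ _ I_ne_zero, cpow_one]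
  intro a b
  fin_cases a <;> fin_cases b
  · refine mk_resolventCoeff_zero_zero n ε ▸ (hprod n n).congr' ?_
    filter_upwards [hev] with lam hl
    simp [hermiteMatrix]
  · refine mk_resolventCoeff_zero_one n ε ▸
      (((hprod n (n + 1)).gauge_mul hu).const_mul hu (-(ε * n))).congr' ?_
    filter_upwards [hev] with lam hl
    have hl0 : lam ≠ 0 := fun h => hl.1 (by simp [h])
    rw [hI, add_sub_cancel_left, cpow_one, neg_add']
    simp only [hermiteMatrix, ← hs]
    simp
    field_simp
  · refine mk_resolventCoeff_one_zero n ε ▸ ((hprod (n - 1) n).gauge_mul hu).congr' ?_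
    filter_upwards [hev] with lam hl
    have hl0 : lam ≠ 0 := fun h => hl.1 (by simp [h])
    rw [sub_sub_cancel, cpow_one]
    simp only [hermiteMatrix]
    simp
    field_simp
  · refine mk_resolventCoeff_one_one n ε ▸
      ((((hprod (n - 1) (n + 1)).gauge_mul hu).gauge_mul hu).const_mul hu (-(ε * n))).congr' ?_
    filter_upwards [hev] with lam hl
    have hl0 : lam ≠ 0 := fun h => hl.1 (by simp [h])
    rw [hI, show n + 1 - (n - 1) = (2 : ℕ) by push_cast; ring, cpow_natCast, neg_add']
    simp only [hermiteMatrix, ← hs]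
    simp
    field_simp

end
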